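/- Let $d\in\{2,3\}$ and let $k\ge 1$ be an integer. Let $T\subset\mathbb{R}^d$ be a mesh cell: a nonempty bounded open polyhedral set, star-shaped with respect to every point of some ball, whose boundary is the union of a finite set $\mathcal{F}_T$ of closed faces; each face $F$ is contained in a hyperplane, has nonempty interior relative to that hyperplane and carries a constant unit normal $n_F$ pointing out of $T$, and distinct faces intersect in sets of zero $(d-1)$-dimensional measure. Let $\mathbb{P}^k(T)$ (resp. $\mathbb{P}^k(F)$) be the space of restrictions to $T$ (resp. to $F$) of polynomials on $\mathbb{R}^d$ of total degree at most $k$, and let $\Pi^k_T:L^2(T)\to\mathbb{P}^k(T)$ and $\Pi^k_F:L^2(F)\to\mathbb{P}^k(F)$ be the $L^2$-orthogonal projections, which act componentwise on vector-valued functions. Set $\hat V^k_T=\mathbb{P}^k(T)^d\times\prod_{F\in\mathcal{F}_T}\mathbb{P}^k(F)^d$. The HHO reduction $\hat I^k_T:H^1(T)^d\to\hat V^k_T$ is defined by $$\hat I^k_T(v)=\bigl(\Pi^k_T v,\ (\Pi^k_F(v|_F))_{F\in\mathcal{F}_T}\bigr),$$ where $v|_F\in L^2(F)^d$ is the trace of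 $v$ on $F$. The divergence reconstruction $D^k_T:\hat V^k_T\to\mathbb{P}^k(T)$ maps $\hat v_T=(v_T,(v_F)_{F\in\mathcal{F}_T})$ to the unique $D^k_T(\hat v_T)\in\mathbb{P}^k(T)$ such that $$\int_T D^k_T(\hat v_T)\,q\,dx=-\int_T v_T\cdot\nabla q\,dx+\sum_{F\in\mathcal{F}_T}\int_F v_F\cdot n_F\,q\,ds\qquad\text{for all }q\in\mathbb{P}^k(T).$$ Then, for every $v\in H^1(T)^d$, $$D^k_T\bigl(\hat I^k_T(v)\bigr)=\Pi^k_T(\operatorname{div} v).$$ -/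

import Mathlib

open MeasureTheory Filter Topology Set
open scoped ContDiff

noncomputable section

namespace HHO

/-- The Euclidean space `ℝ^d`. -/
abbrev E (d : ℕ) : Type := EuclideanSpace ℝ (Fin d)

/-- The partial derivative `∂ᵢ φ` of a (classically differentiable) function. -/
def partialDeriv {d : ℕ} (i : Fin d) (φ : E d → ℝ) (x : E d) : ℝ :=
  fderiv ℝ φ x (EuclideanSpace.single i 1)

/-! ### Mesh cells and their faces -/

/-- The interior of `F` relative to the hyperplane through its points orthogonal to `n`. -/
def relInterior {d : ℕ} (n : E d) (F : Set (E d)) : Set (E d) :=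
  {x | x ∈ F ∧ ∃ r > 0, ∀ y ∈ Metric.ball x r, inner ℝ n (y - x) = 0 → y ∈ F}

/-- A mesh cell: a bounded nonempty open set `T ⊆ ℝ^d`, star-shaped with respect to every point
of some ball, whose boundary is the union of finitely many closed faces. Each face lies in a
hyperplane, has nonempty interior relative to it, and carries a (constant) unit normal pointing
out of `T`; distinct faces overlap only in sets of zero surface measure. Since `∂T` lies in
finitely many hyperplanes, `T` is polyhedral. It need not be convex, and several faces may lie
in the same hyperplane (hanging nodes). -/
structure MeshCell (d : ℕ) where
  carrier : Set (E d)
  isOpen : IsOpen carrier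
  nonempty : carrier.Nonempty
  isBounded : Bornology.IsBounded carrier
  starShaped : ∃ x₀ : E d, ∃ r > 0, ∀ y ∈ Metric.ball x₀ r, StarConvex ℝ y carrier
  /-- the set `𝓕_T` of the faces of `T` -/
  faces : Finset (Set (E d))
  frontier_eq : frontier carrier = ⋃ F ∈ faces, F
  isClosed_face : ∀ F ∈ faces, IsClosed F
  null_overlap : ∀ F ∈ faces, ∀ F' ∈ faces, F ≠ F' → (μHE[d - 1] : Measure (E d)) (F ∩ F') = 0
  /-- the restriction `n_F` of the unit outward normal `n_T` to a face -/
  normal : {F // F ∈ faces} → E d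
  norm_normal : ∀ F, ‖normal F‖ = 1
  planar : ∀ F, ∀ x ∈ F.1, ∀ y ∈ F.1, inner ℝ (normal F) (y - x) = 0
  relInterior_nonempty : ∀ F, (relInterior (normal F) F.1).Nonempty
  outward : ∀ F, ∀ x ∈ relInterior (normal F) F.1,
    ∀ᶠ t : ℝ in 𝓝[>] 0, x - t • normal F ∈ carrier ∧ x + t • normal F ∉ closure carrier

/-! ### Polynomial spaces and projections -/

/-- The classes in `L²(μ)` of the polynomials of total degree at most `k`. -/
def polySpace {d : ℕ} (k : ℕ) (μ : Measure (E d)) : Submodule ℝ (Lp ℝ 2 μ) where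
  carrier := {f | ∃ p ∈ MvPolynomial.restrictTotalDegree (Fin d) ℝ k,
    f =ᵐ[μ] fun x => MvPolynomial.eval x.ofLp p}
  zero_mem' := ⟨0, Submodule.zero_mem _, by
    filter_upwards [Lp.coeFn_zero ℝ 2 μ] with x hx
    rw [hx, Pi.zero_apply, map_zero]⟩
  add_mem' := by
    rintro f g ⟨p, hp, hf⟩ ⟨q, hq, hg⟩
    refine ⟨p + q, Submodule.add_mem _ hp hq, ?_⟩
    filter_upwards [Lp.coeFn_add f g, hf, hg] with x h1 h2 h3
    rw [h1, Pi.add_apply, h2, h3, map_add]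
  smul_mem' := by
    rintro c f ⟨p, hp, hf⟩
    refine ⟨c • p, Submodule.smul_mem _ c hp, ?_⟩
    filter_upwards [Lp.coeFn_smul c f, hf] with x h1 h2
    rw [h1, Pi.smul_apply, h2, MvPolynomial.smul_eval, smul_eq_mul]

instance {d : ℕ} (k : ℕ) (μ : Measure (E d)) : FiniteDimensional ℝ (polySpace k μ) := by
  let W : Submodule ℝ (MvPolynomial.restrictTotalDegree (Fin d) ℝ k) :=
    { carrier := {p | MemLp (fun x : E d => MvPolynomial.eval x.ofLp p.1) 2 μ}
      zero_mem' := by simp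
      add_mem' := by
        intro p q hp hq
        have := MemLp.add hp hq
        simpa [Pi.add_def] using this
      smul_mem' := by
        intro c p hp
        have := MemLp.const_smul hp c
        simpa [Pi.smul_def, MvPolynomial.smul_eval] using this }
  let J : W →ₗ[ℝ] Lp ℝ 2 μ :=
    { toFun := fun p => MemLp.toLp _ p.2
      map_add' := fun p q => by
        rw [← MemLp.toLp_add]
        congr 1
        ext x
        simp
      map_smul' := fun c p => by
        rw [RingHom.id_apply, ← MemLp.toLp_const_smul]
        congr 1
        ext x
        simp [MvPolynomial.smul_eval] }
  have hle : polySpace k μ ≤ LinearMap.range J := by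
    rintro f ⟨p, hp, hf⟩
    have hm : MemLp (fun x : E d => MvPolynomial.eval x.ofLp p) 2 μ :=
      (memLp_congr_ae hf).1 (Lp.memLp f)
    refine ⟨⟨⟨p, hp⟩, hm⟩, ?_⟩
    apply Lp.ext
    exact (MemLp.coeFn_toLp hm).trans hf.symm
  exact Submodule.finiteDimensional_of_le hle

/-- The `L²(μ)`-orthogonal projection onto the polynomials of degree at most `k`. -/
def polyProj {d : ℕ} (k : ℕ) (μ : Measure (E d)) : Lp ℝ 2 μ →L[ℝ] polySpace k μ :=
  (polySpace k μ).orthogonalProjectionOnto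

namespace MeshCell

variable {d : ℕ} (T : MeshCell d)

/-- The type of the faces of `T`. -/
abbrev Face : Type := {F // F ∈ T.faces}

/-- Lebesgue measure on `T`. -/
abbrev vol : Measure (E d) := volume.restrict T.carrier

/-- Surface measure on a face: `(d-1)`-dimensional Hausdorff measure, normalized so that it is
Lebesgue measure on every isometric copy of `ℝ^(d-1)`. -/
abbrev surf (F : T.Face) : Measure (E d) := (μHE[d - 1] : Measure (E d)).restrict F.1

/-- `ℙ^k(T)`, as a subspace of `L²(T)`. -/
abbrev CellPoly (k : ℕ) : Submodule ℝ (Lp ℝ 2 T.vol) := polySpace k T.vol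

/-- `ℙ^k(F)`, as a subspace of `L²(F)`: the polynomials of degree at most `k` in `d - 1` affine
coordinates of the hyperplane of `F` are the restrictions to `F` of the polynomials of degree at
most `k` on `ℝ^d`. -/
abbrev FacePoly (k : ℕ) (F : T.Face) : Submodule ℝ (Lp ℝ 2 (T.surf F)) := polySpace k (T.surf F)

/-! ### The Sobolev space `H¹(T)`, divergence and traces -/

/-- `g` is the weak `i`-th partial derivative of `w` on `T`. -/
def IsWeakDeriv (i : Fin d) (w g : Lp ℝ 2 T.vol) : Prop :=
  ∀ φ : E d → ℝ, ContDiff ℝ ∞ φ → HasCompactSupport φ → tsupport φ ⊆ T.carrier →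
    ∫ x in T.carrier, w x * partialDeriv i φ x = -∫ x in T.carrier, g x * φ x

theorem integrable_mul_test (w : Lp ℝ 2 T.vol) {φ : E d → ℝ} (hφ : Continuous φ)
    (hc : HasCompactSupport φ) : Integrable (fun x => w x * φ x) T.vol :=
  MemLp.integrable_mul (p := 2) (q := 2) (Lp.memLp w)
    (hφ.memLp_of_hasCompactSupport hc)

theorem continuous_partialDeriv (i : Fin d) {φ : E d → ℝ} (hφ : ContDiff ℝ ∞ φ) :
    Continuous (partialDeriv i φ) :=
  (hφ.continuous_fderiv (by simp)).clm_apply continuous_const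

theorem hasCompactSupport_partialDeriv (i : Fin d) {φ : E d → ℝ} (hc : HasCompactSupport φ) :
    HasCompactSupport (partialDeriv i φ) :=
  (hc.fderiv (𝕜 := ℝ)).comp_left (g := fun L : E d →L[ℝ] ℝ => L (EuclideanSpace.single i 1)) rfl

/-- `H¹(T)`: the functions in `L²(T)` all of whose weak partial derivatives are in `L²(T)`. -/
def H1 : Submodule ℝ (Lp ℝ 2 T.vol) where
  carrier := {w | ∀ i, ∃ g : Lp ℝ 2 T.vol, T.IsWeakDeriv i w g}
  zero_mem' := fun i => ⟨0, fun φ _ _ _ => by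
    have h0 : ∀ ψ : E d → ℝ, ∫ x in T.carrier, (0 : Lp ℝ 2 T.vol) x * ψ x = 0 := fun ψ => by
      apply integral_eq_zero_of_ae
      filter_upwards [Lp.coeFn_zero ℝ 2 T.vol] with x hx
      rw [hx, Pi.zero_apply, zero_mul]
    rw [h0, h0, neg_zero]⟩
  add_mem' := by
    intro w w' hw hw' i
    obtain ⟨g, hg⟩ := hw i
    obtain ⟨g', hg'⟩ := hw' i
    refine ⟨g + g', fun φ h1 h2 h3 => ?_⟩
    have hd1 := continuous_partialDeriv i h1
    have hd2 := hasCompactSupport_partialDeriv i h2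
    have e1 : ∫ x in T.carrier, (w + w' : Lp ℝ 2 T.vol) x * partialDeriv i φ x
        = ∫ x in T.carrier, (w x * partialDeriv i φ x + w' x * partialDeriv i φ x) := by
      apply integral_congr_ae
      filter_upwards [Lp.coeFn_add w w'] with x hx
      rw [hx, Pi.add_apply, add_mul]
    have e2 : ∫ x in T.carrier, (g + g' : Lp ℝ 2 T.vol) x * φ x
        = ∫ x in T.carrier, (g x * φ x + g' x * φ x) := by
      apply integral_congr_ae
      filter_upwards [Lp.coeFn_add g g'] with x hx
      rw [hx, Pi.add_apply, add_mul]
    rw [e1, e2, integral_add (T.integrable_mul_test w hd1 hd2) (T.integrable_mul_test w' hd1 hd2),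
      integral_add (T.integrable_mul_test g h1.continuous h2)
        (T.integrable_mul_test g' h1.continuous h2), hg φ h1 h2 h3, hg' φ h1 h2 h3]
    ring
  smul_mem' := by
    intro c w hw i
    obtain ⟨g, hg⟩ := hw i
    refine ⟨c • g, fun φ h1 h2 h3 => ?_⟩
    have e1 : ∫ x in T.carrier, (c • w : Lp ℝ 2 T.vol) x * partialDeriv i φ x
        = ∫ x in T.carrier, c * (w x * partialDeriv i φ x) := by
      apply integral_congr_ae
      filter_upwards [Lp.coeFn_smul c w] with x hx
      rw [hx, Pi.smul_apply, smul_eq_mul, mul_assoc]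
    have e2 : ∫ x in T.carrier, (c • g : Lp ℝ 2 T.vol) x * φ x
        = ∫ x in T.carrier, c * (g x * φ x) := by
      apply integral_congr_ae
      filter_upwards [Lp.coeFn_smul c g] with x hx
      rw [hx, Pi.smul_apply, smul_eq_mul, mul_assoc]
    rw [e1, e2, integral_const_mul, integral_const_mul, hg φ h1 h2 h3]
    ring

/-- The weak partial derivative `∂ᵢ w ∈ L²(T)` of `w ∈ H¹(T)`. -/
def weakDeriv (i : Fin d) (w : T.H1) : Lp ℝ 2 T.vol := Classical.choose (w.2 i)

theorem isWeakDeriv_weakDeriv (i : Fin d) (w : T.H1) : T.IsWeakDeriv i w (T.weakDeriv i w) :=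
  Classical.choose_spec (w.2 i)

/-- The divergence `div v ∈ L²(T)` of `v ∈ H¹(T)^d`. -/
def div (v : Fin d → T.H1) : Lp ℝ 2 T.vol := ∑ i, T.weakDeriv i (v i)

/-- `g ∈ L²(F)` is the trace of `w ∈ H¹(T)` on the face `F`: for some functions `φₙ` that are
smooth up to the boundary of `T`, `φₙ → w` in `H¹(T)` and `φₙ|_F → g` in `L²(F)`. -/
def IsTrace (F : T.Face) (w : T.H1) (g : Lp ℝ 2 (T.surf F)) : Prop :=
  ∃ φ : ℕ → E d → ℝ, (∀ n, ContDiff ℝ ∞ (φ n)) ∧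
    Tendsto (fun n => eLpNorm (fun x => φ n x - w.1 x) 2 T.vol) atTop (𝓝 0) ∧
    (∀ i, Tendsto (fun n => eLpNorm (fun x => partialDeriv i (φ n) x - T.weakDeriv i w x) 2 T.vol)
      atTop (𝓝 0)) ∧
    Tendsto (fun n => eLpNorm (fun x => φ n x - g x) 2 (T.surf F)) atTop (𝓝 0)

open Classical in
/-- The trace `w|_F ∈ L²(F)` of `w ∈ H¹(T)`. (By the trace theorem the first case always
occurs, and `g` is unique.) -/
def trace (F : T.Face) (w : T.H1) : Lp ℝ 2 (T.surf F) :=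
  if h : ∃ g, T.IsTrace F w g then Classical.choose h else 0

/-! ### The local HHO space, the reduction and the divergence reconstruction -/

/-- The local HHO space `ℙ^k(T)^d × ∏_{F ∈ 𝓕_T} ℙ^k(F)^d`. -/
abbrev HHOSpace (k : ℕ) : Type :=
  (Fin d → T.CellPoly k) × ((F : T.Face) → Fin d → T.FacePoly k F)

/-- The local HHO reduction: the componentwise `L²`-orthogonal projections of `v` on the cell
and of the trace of `v` on the faces. -/
def reduction (k : ℕ) (v : Fin d → T.H1) : T.HHOSpace k :=
  (fun i => polyProj k T.vol (v i), fun F i => polyProj k (T.surf F) (T.trace F (v i)))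

/-- The right-hand side `-(v_T, ∇q)_T + (v_∂T, q n_T)_∂T` of the problem that defines the
divergence reconstruction. -/
def divRhs {k : ℕ} (vh : T.HHOSpace k) (q : MvPolynomial (Fin d) ℝ) : ℝ :=
  -(∫ x in T.carrier, ∑ i, (vh.1 i : Lp ℝ 2 T.vol) x *
      MvPolynomial.eval x.ofLp (MvPolynomial.pderiv i q)) +
    ∑ F : T.Face, ∫ x, ∑ i, (vh.2 F i : Lp ℝ 2 (T.surf F)) x *
      (MvPolynomial.eval x.ofLp q * T.normal F i) ∂(T.surf F)

theorem isBounded_face (F : T.Face) : Bornology.IsBounded F.1 := by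
  refine T.isBounded.closure.subset (Subset.trans ?_ frontier_subset_closure)
  rw [T.frontier_eq]
  exact subset_biUnion_of_mem (u := fun F : Set (E d) => F) F.2

theorem surf_lt_top (F : T.Face) : (μHE[d - 1] : Measure (E d)) F.1 < ⊤ := by
  obtain ⟨x₀, hx₀, -⟩ := T.relInterior_nonempty F
  have hn : T.normal F ≠ 0 := by
    intro h
    have := T.norm_normal F
    simp [h] at this
  let V : Submodule ℝ (E d) := (Submodule.span ℝ {T.normal F})ᗮ
  have hV : Module.finrank ℝ V = d - 1 := by
    have h := (Submodule.span ℝ {T.normal F}).finrank_add_finrank_orthogonal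
    rw [finrank_span_singleton hn, finrank_euclideanSpace_fin] at h
    change Module.finrank ℝ (Submodule.span ℝ {T.normal F})ᗮ = d - 1
    omega
  let f : V → E d := fun v => v.1 + x₀
  have hf : Isometry f := by
    intro a b
    simp [f, Subtype.edist_eq]
  have himg : f '' (f ⁻¹' F.1) = F.1 := by
    apply image_preimage_eq_of_subset
    intro y hy
    refine ⟨⟨y - x₀, ?_⟩, by simp [f]⟩
    rw [Submodule.mem_orthogonal_singleton_iff_inner_right]
    exact T.planar F x₀ hx₀ y hy
  have hcl : IsClosed (f ⁻¹' F.1) := (T.isClosed_face F.1 F.2).preimage hf.continuous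
  have hbd : Bornology.IsBounded (f ⁻¹' F.1) :=
    hf.antilipschitz.isBounded_preimage (T.isBounded_face F)
  have hK : IsCompact (f ⁻¹' F.1) := Metric.isCompact_of_isClosed_isBounded hcl hbd
  rw [← himg, hf.euclideanHausdorffMeasure_image, ← hV]
  exact hK.measure_lt_top

theorem memLp_of_isBounded {μ : Measure (E d)} {S : Set (E d)} (hS : Bornology.IsBounded S)
    (hm : MeasurableSet S) (hμ : μ S < ⊤) {f : E d → ℝ} (hf : Continuous f) :
    MemLp f 2 (μ.restrict S) := by
  have : IsFiniteMeasure (μ.restrict S) := ⟨by simpa using hμ⟩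
  have hK : IsCompact (closure S) := hS.isCompact_closure
  obtain ⟨C, hC⟩ := hK.exists_bound_of_continuousOn hf.continuousOn
  refine MemLp.of_bound hf.aestronglyMeasurable C ?_
  filter_upwards [ae_restrict_mem hm] with x hx
  exact hC x (subset_closure hx)

theorem continuous_eval (p : MvPolynomial (Fin d) ℝ) :
    Continuous fun x : E d => MvPolynomial.eval x.ofLp p :=
  (MvPolynomial.continuous_eval p).comp (PiLp.continuous_ofLp 2 _)

theorem memLp_cell (p : MvPolynomial (Fin d) ℝ) :
    MemLp (fun x : E d => MvPolynomial.eval x.ofLp p) 2 T.vol :=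
  memLp_of_isBounded T.isBounded T.isOpen.measurableSet T.isBounded.measure_lt_top
    (continuous_eval p)

theorem memLp_face (F : T.Face) (p : MvPolynomial (Fin d) ℝ) :
    MemLp (fun x : E d => MvPolynomial.eval x.ofLp p) 2 (T.surf F) :=
  memLp_of_isBounded (T.isBounded_face F) (T.isClosed_face F.1 F.2).measurableSet
    (T.surf_lt_top F) (continuous_eval p)

theorem eq_zero_of_ae_eq_zero {p : MvPolynomial (Fin d) ℝ}
    (h : (fun x : E d => MvPolynomial.eval x.ofLp p) =ᵐ[T.vol] 0) : p = 0 := by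
  have h1 : EqOn (fun x : E d => MvPolynomial.eval x.ofLp p) 0 T.carrier :=
    Measure.eqOn_open_of_ae_eq h T.isOpen (continuous_eval p).continuousOn continuousOn_const
  obtain ⟨x₀, hx₀⟩ := T.nonempty
  have ho : IsOpen (WithLp.ofLp '' T.carrier : Set (Fin d → ℝ)) :=
    (PiLp.homeomorph 2 (fun _ : Fin d => ℝ)).isOpenMap _ T.isOpen
  obtain ⟨r, hr, hball⟩ := Metric.isOpen_iff.1 ho x₀.ofLp ⟨x₀, hx₀, rfl⟩
  refine MvPolynomial.funext_set (s := fun i => Metric.ball (x₀.ofLp i) r) (fun i => ?_) ?_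
  · rw [Real.ball_eq_Ioo]
    exact Ioo_infinite (by linarith)
  · intro y hy
    rw [← ball_pi _ hr] at hy
    obtain ⟨x, hx, rfl⟩ := hball hy
    simpa using h1 hx

theorem divRhs_add {k : ℕ} (vh : T.HHOSpace k) (p q : MvPolynomial (Fin d) ℝ) :
    T.divRhs vh (p + q) = T.divRhs vh p + T.divRhs vh q := by
  have hc : ∀ (q : MvPolynomial (Fin d) ℝ), Integrable (fun x => ∑ i, (vh.1 i : Lp ℝ 2 T.vol) x *
      MvPolynomial.eval x.ofLp (MvPolynomial.pderiv i q)) T.vol := fun q =>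
    integrable_finsetSum _ fun i _ => (Lp.memLp _).integrable_mul (T.memLp_cell _)
  have hs : ∀ (F : T.Face) (q : MvPolynomial (Fin d) ℝ),
      Integrable (fun x => ∑ i, (vh.2 F i : Lp ℝ 2 (T.surf F)) x *
        (MvPolynomial.eval x.ofLp q * T.normal F i)) (T.surf F) := fun F q =>
    integrable_finsetSum _ fun i _ =>
      (Lp.memLp _).integrable_mul ((T.memLp_face F q).mul_const _)
  simp only [divRhs]
  rw [← sub_eq_zero]
  simp only [map_add, mul_add, add_mul, Finset.sum_add_distrib]
  rw [integral_add (hc p) (hc q)]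
  simp_rw [fun F => integral_add (hs F p) (hs F q)]
  rw [Finset.sum_add_distrib]
  ring

theorem divRhs_smul {k : ℕ} (vh : T.HHOSpace k) (c : ℝ) (q : MvPolynomial (Fin d) ℝ) :
    T.divRhs vh (c • q) = c * T.divRhs vh q := by
  have e1 : ∀ a b : ℝ, a * (c * b) = c * (a * b) := fun a b => by ring
  simp only [divRhs, Derivation.map_smul, MvPolynomial.smul_eval, mul_assoc, e1,
    ← Finset.mul_sum, integral_const_mul]
  ring

/-- The problem that defines the divergence reconstruction is well posed. -/
theorem existsUnique_divRec {k : ℕ} (vh : T.HHOSpace k) :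
    ∃! D : T.CellPoly k, ∀ q ∈ MvPolynomial.restrictTotalDegree (Fin d) ℝ k,
      ∫ x in T.carrier, (D : Lp ℝ 2 T.vol) x * MvPolynomial.eval x.ofLp q = T.divRhs vh q := by
  let P := MvPolynomial.restrictTotalDegree (Fin d) ℝ k
  let J : P →ₗ[ℝ] T.CellPoly k :=
    { toFun := fun p => ⟨(T.memLp_cell p.1).toLp _, p.1, p.2, MemLp.coeFn_toLp _⟩
      map_add' := fun p q => by
        ext1
        refine (MemLp.toLp_congr (T.memLp_cell (p + q).1)
          ((T.memLp_cell p.1).add (T.memLp_cell q.1)) ?_).trans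
          (MemLp.toLp_add (T.memLp_cell p.1) (T.memLp_cell q.1))
        filter_upwards with x
        simp
      map_smul' := fun c p => by
        ext1
        refine (MemLp.toLp_congr (T.memLp_cell (c • p).1)
          ((T.memLp_cell p.1).const_smul c) ?_).trans
          (MemLp.toLp_const_smul c (T.memLp_cell p.1))
        filter_upwards with x
        simp [MvPolynomial.smul_eval] }
  have hJ : ∀ p : P, (J p : Lp ℝ 2 T.vol) =ᵐ[T.vol] fun x => MvPolynomial.eval x.ofLp p.1 :=
    fun p => MemLp.coeFn_toLp (T.memLp_cell p.1)
  have hinj : Function.Injective J := by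
    rw [← LinearMap.ker_eq_bot, LinearMap.ker_eq_bot']
    intro p hp
    have h := hJ p
    rw [hp] at h
    have h0 := T.eq_zero_of_ae_eq_zero (h.symm.trans (Lp.coeFn_zero ℝ 2 T.vol))
    exact Subtype.ext h0
  have hsurj : Function.Surjective J := by
    rintro ⟨f, p, hp, hf⟩
    exact ⟨⟨p, hp⟩, Subtype.ext (Lp.ext ((hJ ⟨p, hp⟩).trans hf.symm))⟩
  let e := LinearEquiv.ofBijective J ⟨hinj, hsurj⟩
  let ℓ : P →ₗ[ℝ] ℝ :=
    { toFun := fun q => T.divRhs vh q.1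
      map_add' := fun p q => T.divRhs_add vh p.1 q.1
      map_smul' := fun c q => T.divRhs_smul vh c q.1 }
  let L : T.CellPoly k →L[ℝ] ℝ := LinearMap.toContinuousLinearMap (ℓ ∘ₗ e.symm.toLinearMap)
  have hin : ∀ (D : T.CellPoly k) (q : P), inner ℝ D (J q)
      = ∫ x in T.carrier, (D : Lp ℝ 2 T.vol) x * MvPolynomial.eval x.ofLp q.1 := by
    intro D q
    rw [Submodule.coe_inner, L2.inner_def]
    apply integral_congr_ae
    filter_upwards [hJ q] with x hx
    simp [hx, mul_comm]
  have hL : ∀ q : P, L (J q) = T.divRhs vh q.1 := by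
    intro q
    change ℓ (e.symm (e q)) = _
    rw [e.symm_apply_apply]
    rfl
  refine ⟨(InnerProductSpace.toDual ℝ (T.CellPoly k)).symm L, fun q hq => ?_, fun D hD => ?_⟩
  · rw [← hin _ ⟨q, hq⟩, InnerProductSpace.toDual_symm_apply, hL]
  · apply ext_inner_right ℝ
    intro p
    obtain ⟨q, rfl⟩ := hsurj p
    rw [InnerProductSpace.toDual_symm_apply, hL, hin, hD q.1 q.2]

/-- The divergence reconstruction: the unique polynomial `D ∈ ℙ^k(T)` such that
`(D, q)_T = -(v_T, ∇q)_T + (v_∂T, q n_T)_∂T` for every `q ∈ ℙ^k(T)`. -/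
def divRec {k : ℕ} (vh : T.HHOSpace k) : T.CellPoly k :=
  Classical.choose (T.existsUnique_divRec vh).exists

theorem divRec_spec {k : ℕ} (vh : T.HHOSpace k) (q : MvPolynomial (Fin d) ℝ)
    (hq : q ∈ MvPolynomial.restrictTotalDegree (Fin d) ℝ k) :
    ∫ x in T.carrier, (T.divRec vh : Lp ℝ 2 T.vol) x * MvPolynomial.eval x.ofLp q
      = T.divRhs vh q :=
  Classical.choose_spec (T.existsUnique_divRec vh).exists q hq

end MeshCell

end HHO

end

/-! Both sides lie in `ℙ^k(T)`, so they are compared by testing with polynomials `q` of degree at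
most `k`. In the problem defining `divRec`, the components of `∇q` have degree at most `k` and each
`n_F` is constant, so orthogonality removes the cell and face projections (`integral_polyProj_mul`).
What remains is `∫ div v q` by integration by parts (`integral_weakDeriv_mul`), and this equals `∫
Π(div v) q`.

The substance is therefore Green's formula for `H¹` functions on a star-shaped polyhedral cell. For
smooth `φ` and a vertex `y` in the star ball, the cell is, up to null sets, a disjoint union of
cones from `y` over the faces. Integrating along rays shows that the radial field `φ (x - y)` has
flux `φ` times the height of `y` through each face (`IsStarBall.integral_radial`). Subtracting this
identity for two vertices differing by a multiple of `e` gives the divergence theorem for `φ e`.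
Applied to `φ²`, the same identity gives the trace inequality (`exists_integral_sq_le`).

To reach `H¹`, a function extended by zero is averaged over contractions `x ↦ s x + (1 - s) z`, with
`z` in the star ball. These map the cell into itself, so the averages are smooth up to the boundary
and commute there with weak derivatives up to the factor `s`; letting `s → 1` gives density. The
trace inequality then makes traces exist and be independent of the approximation, and the smooth
formula passes to the limit. -/

noncomputable section

namespace HHO

/-! ### Integration over cones -/

/-- The open cone with vertex `y` over the base `A`, without its vertex. -/
def cone {d : ℕ} (y : E d) (A : Set (E d)) : Set (E d) :=
  {x | ∃ t ∈ Ioo (0 : ℝ) 1, ∃ p ∈ A, x = y + t • (p - y)}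

section Cone

variable {d : ℕ} {y n : E d} {h : ℝ} {A : Set (E d)}

/-- Radial projection from `y` to the hyperplane at height `h` recovers the base point. In this form
the cone is an intersection of preimages under measurable maps. -/
theorem mem_cone_iff_of_inner_eq (hh : 0 < h) (hA : ∀ p ∈ A, inner ℝ n (p - y) = h) {x : E d} :
    x ∈ cone y A ↔ (inner ℝ n (x - y) ∈ Ioo 0 h ∧ y + (h / inner ℝ n (x - y)) • (x - y) ∈ A) := by
  constructor
  · rintro ⟨t, ht, p, hp, rfl⟩
    have e : inner ℝ n (y + t • (p - y) - y) = t * h := by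
      rw [add_sub_cancel_left, inner_smul_right, hA p hp]
    rw [e]
    refine ⟨⟨mul_pos ht.1 hh, by nlinarith [ht.2]⟩, ?_⟩
    have : h / (t * h) * t = 1 := by
      have := ht.1.ne'
      field_simp
    rw [add_sub_cancel_left, smul_smul, this, one_smul]
    simpa using hp
  · rintro ⟨⟨h0, h1⟩, hx⟩
    refine ⟨inner ℝ n (x - y) / h, ⟨div_pos h0 hh, (div_lt_one hh).2 h1⟩, _, hx, ?_⟩
    have : inner ℝ n (x - y) / h * (h / inner ℝ n (x - y)) = 1 := by
      have := h0.ne'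
      field_simp
    rw [add_sub_cancel_left, smul_smul, this, one_smul]
    simp

theorem measurableSet_cone (hh : 0 < h) (hA : ∀ p ∈ A, inner ℝ n (p - y) = h)
    (hm : MeasurableSet A) : MeasurableSet (cone y A) := by
  have e : cone y A = (fun x => inner ℝ n (x - y)) ⁻¹' Ioo 0 h ∩
      (fun x => y + (h / inner ℝ n (x - y)) • (x - y)) ⁻¹' A := by
    ext x
    exact mem_cone_iff_of_inner_eq hh hA
  rw [e]
  refine MeasurableSet.inter ?_ ?_
  · exact measurableSet_Ioo.preimage (by fun_prop)
  · exact hm.preimage (by fun_prop)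

/-- Cavalieri's principle: the slice of the cone at height `t * h` is a copy of the base contracted
by `t`, so its surface measure scales by `t ^ (d - 1)`. -/
theorem volume_inter_cone (hn : ‖n‖ = 1) (hh : 0 < h)
    (hA : ∀ p ∈ A, inner ℝ n (p - y) = h) (hm : MeasurableSet A) {B : Set (E d)}
    (hB : MeasurableSet B) :
    volume (B ∩ cone y A) = ∫⁻ t in Ioo (0 : ℝ) 1, ENNReal.ofReal (h * t ^ (d - 1)) *
      (μHE[d - 1] : Measure (E d)) (A ∩ {p | y + t • (p - y) ∈ B}) := by
  have hn0 : h • n ≠ 0 := by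
    refine smul_ne_zero hh.ne' ?_
    rintro rfl
    simp at hn
  have hC := hB.inter (measurableSet_cone hh hA hm)
  -- Slicing along `h • n` rather than `n` makes the parameter equal to the contraction ratio; the
  -- length of `h • n` supplies the factor `h`.
  have key := EuclideanGeometry.euclideanHausdorffMeasure_eq_lintegral (P := E d) y hn0 hC
  rw [finrank_euclideanSpace_fin, EuclideanSpace.euclideanHausdorffMeasure_eq_volume] at key
  rw [key, ← lintegral_const_mul' _ _ (by simp), ← lintegral_indicator measurableSet_Ioo]
  congr 1
  ext t
  have hmem : ∀ x : E d, x ∈ AffineSubspace.mk' (t • h • n +ᵥ y) (Submodule.span ℝ {h • n})ᗮ ↔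
      inner ℝ n (x - y) = t * h := by
    intro x
    rw [AffineSubspace.mem_mk', Submodule.mem_orthogonal_singleton_iff_inner_right]
    rw [vsub_eq_sub, vadd_eq_add, real_inner_smul_left, mul_eq_zero, or_iff_right hh.ne',
      ← sub_sub, sub_right_comm, inner_sub_right, sub_eq_zero, inner_smul_right, inner_smul_right,
      real_inner_self_eq_norm_sq, hn, one_pow, mul_one]
  by_cases ht : t ∈ Ioo (0 : ℝ) 1
  · rw [indicator_of_mem ht]
    have himg : B ∩ cone y A ∩
        (AffineSubspace.mk' (t • h • n +ᵥ y) (Submodule.span ℝ {h • n})ᗮ : Set (E d)) =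
        AffineMap.homothety y t '' (A ∩ {p | y + t • (p - y) ∈ B}) := by
      ext x
      simp only [mem_inter_iff, SetLike.mem_coe, hmem, mem_image]
      simp only [mem_ofPred_eq, AffineMap.homothety_apply, vsub_eq_sub, vadd_eq_add]
      constructor
      · rintro ⟨⟨hxB, s, hs, p, hp, rfl⟩, hx⟩
        rw [add_sub_cancel_left, inner_smul_right, hA p hp] at hx
        obtain rfl := mul_right_cancel₀ hh.ne' hx
        exact ⟨p, ⟨hp, hxB⟩, add_comm _ _⟩
      · rintro ⟨p, ⟨hp, hpB⟩, rfl⟩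
        rw [add_comm, add_sub_cancel_left, inner_smul_right, hA p hp]
        exact ⟨⟨hpB, t, ht, p, hp, rfl⟩, rfl⟩
    rw [himg, euclideanHausdorffMeasure_homothety_image _ _ ht.1.ne', ENNReal.smul_def, smul_eq_mul,
      ← mul_assoc]
    congr 1
    rw [enorm_smul, ← ofReal_norm n, hn, ENNReal.ofReal_one, mul_one,
      ENNReal.ofReal_mul hh.le, Real.enorm_eq_ofReal hh.le, ENNReal.ofReal_pow ht.1.le,
      ENNReal.coe_pow, ← enorm_eq_nnnorm, Real.enorm_eq_ofReal ht.1.le]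
  · rw [indicator_of_notMem ht]
    have hemp : B ∩ cone y A ∩
        (AffineSubspace.mk' (t • h • n +ᵥ y) (Submodule.span ℝ {h • n})ᗮ : Set (E d)) = ∅ := by
      rw [eq_empty_iff_forall_notMem]
      rintro x ⟨⟨-, s, hs, p, hp, rfl⟩, hx⟩
      rw [SetLike.mem_coe, hmem, add_sub_cancel_left, inner_smul_right, hA p hp] at hx
      obtain rfl := mul_right_cancel₀ hh.ne' hx
      exact ht hs
    rw [hemp, measure_empty, mul_zero]

/-- Lebesgue measure on the cone with vertex `y` over a piece `A` of a hyperplane, in the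
coordinates `(t, p) ↦ y + t (p - y)`. -/
theorem volume_restrict_cone (hn : ‖n‖ = 1) (hh : 0 < h)
    (hA : ∀ p ∈ A, inner ℝ n (p - y) = h) (hm : MeasurableSet A)
    (hfin : (μHE[d - 1] : Measure (E d)) A < ⊤) :
    (volume : Measure (E d)).restrict (cone y A) =
      Measure.map (fun z : ℝ × E d => y + z.1 • (z.2 - y))
        (((volume.restrict (Ioo (0 : ℝ) 1)).withDensity
          fun t => ENNReal.ofReal (h * t ^ (d - 1))).prod
        ((μHE[d - 1] : Measure (E d)).restrict A)) := by
  have : IsFiniteMeasure ((μHE[d - 1] : Measure (E d)).restrict A) := ⟨by simpa using hfin⟩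
  have hΨ : Measurable fun z : ℝ × E d => y + z.1 • (z.2 - y) := by fun_prop
  ext B hB
  rw [Measure.restrict_apply hB, volume_inter_cone hn hh hA hm hB, Measure.map_apply hΨ hB,
    Measure.prod_apply (hΨ hB), lintegral_withDensity_eq_lintegral_mul _ (by fun_prop)
      (measurable_measure_prodMk_left (hΨ hB))]
  refine lintegral_congr fun t => ?_
  rw [Pi.mul_apply, Measure.restrict_apply (measurable_prodMk_left (hΨ hB)), inter_comm]
  rfl

theorem integral_cone (hn : ‖n‖ = 1) (hh : 0 < h)
    (hA : ∀ p ∈ A, inner ℝ n (p - y) = h) (hm : MeasurableSet A)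
    (hfin : (μHE[d - 1] : Measure (E d)) A < ⊤) {G : E d → ℝ} (hG : Continuous G)
    (hGi : IntegrableOn G (cone y A)) :
    ∫ x in cone y A, G x = ∫ p in A, h * (∫ t in (0 : ℝ)..1, t ^ (d - 1) * G (y + t • (p - y)))
      ∂(μHE[d - 1] : Measure (E d)) := by
  have : IsFiniteMeasure ((μHE[d - 1] : Measure (E d)).restrict A) := ⟨by simpa using hfin⟩
  have hΨ : Measurable fun z : ℝ × E d => y + z.1 • (z.2 - y) := by fun_prop
  rw [IntegrableOn, volume_restrict_cone hn hh hA hm hfin,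
    integrable_map_measure hG.aestronglyMeasurable hΨ.aemeasurable] at hGi
  rw [volume_restrict_cone hn hh hA hm hfin, integral_map hΨ.aemeasurable hG.aestronglyMeasurable,
    integral_prod_symm (fun z : ℝ × E d => G (y + z.1 • (z.2 - y))) hGi]
  refine integral_congr_ae (Eventually.of_forall fun p => ?_)
  change ∫ t, G (y + t • (p - y)) ∂((volume.restrict (Ioo (0 : ℝ) 1)).withDensity
    fun t => ENNReal.ofReal (h * t ^ (d - 1))) =
    h * ∫ t in (0 : ℝ)..1, t ^ (d - 1) * G (y + t • (p - y))
  rw [integral_withDensity_eq_integral_toReal_smul (by fun_prop) (by simp),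
    intervalIntegral.integral_of_le zero_le_one, integral_Ioc_eq_integral_Ioo, ← integral_const_mul]
  refine setIntegral_congr_fun measurableSet_Ioo fun t ht => ?_
  have := pow_nonneg ht.1.le (d - 1)
  simp only [smul_eq_mul, ENNReal.toReal_ofReal (mul_nonneg hh.le this)]
  ring

/-- The divergence theorem on a cone for a field `φ (x - y)` along the rays from the vertex. -/
theorem integral_cone_radial (hd : 1 ≤ d) (hn : ‖n‖ = 1) (hh : 0 < h)
    (hA : ∀ p ∈ A, inner ℝ n (p - y) = h) (hm : MeasurableSet A)
    (hfin : (μHE[d - 1] : Measure (E d)) A < ⊤) {φ : E d → ℝ} (hφ : ContDiff ℝ 1 φ)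
    (hi : IntegrableOn (fun x => d * φ x + fderiv ℝ φ x (x - y)) (cone y A)) :
    ∫ x in cone y A, (d * φ x + fderiv ℝ φ x (x - y)) =
      ∫ p in A, φ p * h ∂(μHE[d - 1] : Measure (E d)) := by
  have hD := hφ.continuous_fderiv (by simp)
  have hφc := hφ.continuous
  have hG : Continuous fun x => d * φ x + fderiv ℝ φ x (x - y) :=
    (continuous_const.mul hφc).add (hD.clm_apply (by fun_prop))
  rw [integral_cone hn hh hA hm hfin hG hi]
  refine integral_congr_ae (Eventually.of_forall fun p => ?_)
  -- Along a ray the weighted integrand is an exact derivative, and the boundary term at the vertex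
  -- vanishes because `1 ≤ d`.
  have hder : ∀ t : ℝ, HasDerivAt (fun t : ℝ => t ^ d * φ (y + t • (p - y)))
      (t ^ (d - 1) * (d * φ (y + t • (p - y)) +
        fderiv ℝ φ (y + t • (p - y)) (y + t • (p - y) - y))) t := by
    intro t
    have h1 : HasDerivAt (fun t : ℝ => y + t • (p - y)) (p - y) t := by
      simpa using ((hasDerivAt_id t).smul_const (p - y)).const_add y
    have h2 := ((hφ.differentiable (by simp)) (y + t • (p - y))).hasFDerivAt.comp_hasDerivAt t h1
    refine ((hasDerivAt_pow d t).mul h2).congr_deriv ?_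
    rw [add_sub_cancel_left, map_smul, smul_eq_mul]
    obtain ⟨m, rfl⟩ : ∃ m, d = m + 1 := ⟨d - 1, by omega⟩
    simp only [Nat.add_sub_cancel, Function.comp_apply]
    ring
  have hcont : Continuous fun t : ℝ => t ^ (d - 1) * (d * φ (y + t • (p - y)) +
      fderiv ℝ φ (y + t • (p - y)) (y + t • (p - y) - y)) :=
    (continuous_pow _).mul (hG.comp (by fun_prop))
  have := intervalIntegral.integral_eq_sub_of_hasDerivAt (a := 0) (b := 1)
    (fun t _ => hder t) (hcont.intervalIntegrable _ _)
  simp only [this]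
  simp [show d ≠ 0 by omega, mul_comm]

end Cone

end HHO

end

noncomputable section

namespace HHO
namespace MeshCell

variable {d : ℕ} (T : MeshCell d)

/-! ### Geometry of a mesh cell -/

/-- `T` is star-shaped with respect to every point of the ball `B(x₀, r)`. -/
def IsStarBall (x₀ : E d) (r : ℝ) : Prop :=
  0 < r ∧ ∀ y ∈ Metric.ball x₀ r, StarConvex ℝ y T.carrier

theorem exists_isStarBall : ∃ x₀ r, T.IsStarBall x₀ r := by
  obtain ⟨x₀, r, hr, h⟩ := T.starShaped
  exact ⟨x₀, r, hr, h⟩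

theorem face_subset_frontier (F : T.Face) : F.1 ⊆ frontier T.carrier := by
  rw [T.frontier_eq]
  exact subset_biUnion_of_mem (u := fun F : Set (E d) => F) F.2

theorem face_subset_closure (F : T.Face) : F.1 ⊆ closure T.carrier :=
  (T.face_subset_frontier F).trans frontier_subset_closure

theorem notMem_of_mem_frontier {p : E d} (hp : p ∈ frontier T.carrier) : p ∉ T.carrier := by
  rw [T.isOpen.frontier_eq] at hp
  exact hp.2

variable {T} {x₀ y : E d} {r : ℝ}

theorem IsStarBall.mem_of_mem (hB : T.IsStarBall x₀ r) (hy : y ∈ Metric.ball x₀ r) {p : E d}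
    (hp : p ∈ T.carrier) {t : ℝ} (h0 : 0 ≤ t) (h1 : t ≤ 1) : y + t • (p - y) ∈ T.carrier :=
  (hB.2 y hy).add_smul_sub_mem hp h0 h1

theorem IsStarBall.mem_carrier (hB : T.IsStarBall x₀ r) (hy : y ∈ Metric.ball x₀ r) :
    y ∈ T.carrier := by
  obtain ⟨p, hp⟩ := T.nonempty
  simpa using hB.mem_of_mem hy hp le_rfl zero_le_one

/-- The target point is kept fixed while `p` is replaced by a nearby point of the cell; the vertex
moves to compensate and stays in the open ball. Since `t < 1`, the vertex has positive weight and
can absorb the change. -/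
theorem IsStarBall.mem_of_mem_closure (hB : T.IsStarBall x₀ r) (hy : y ∈ Metric.ball x₀ r)
    {p : E d} (hp : p ∈ closure T.carrier) {t : ℝ} (h0 : 0 ≤ t) (h1 : t < 1) :
    y + t • (p - y) ∈ T.carrier := by
  have h1' : 1 - t ≠ 0 := by linarith
  -- the vertex for which the segment to a nearby point `p'` passes through the given point
  let v : E d → E d := fun p' => y + (t / (1 - t)) • (p - p')
  have hv : ∀ᶠ p' in 𝓝 p, v p' ∈ Metric.ball x₀ r := by
    have hc : ContinuousAt v p := by fun_prop
    apply hc.eventually_mem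
    simpa [v] using Metric.isOpen_ball.mem_nhds hy
  obtain ⟨p', hp', hvp⟩ := ((mem_closure_iff_frequently.1 hp).and_eventually hv).exists
  have h := hB.mem_of_mem hvp hp' h0 h1.le
  convert h using 1
  have e : t / (1 - t) = t + t * (t / (1 - t)) := by field_simp; ring
  simp only [v]
  match_scalars <;> field_simp <;> ring

/-- If `y` were strictly on the outer side of the face, a point `x + s n` just outside the cell
would lie on a segment from `y` to the face, and star-shapedness would put it inside. -/
theorem IsStarBall.inner_nonneg_of_mem_relInterior (hB : T.IsStarBall x₀ r)
    (hy : y ∈ Metric.ball x₀ r) (F : T.Face) {x : E d} (hx : x ∈ relInterior (T.normal F) F.1) :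
    0 ≤ inner ℝ (T.normal F) (x - y) := by
  by_contra! hlt
  set n := T.normal F with hn
  have hnn : inner ℝ n n = 1 := by
    rw [real_inner_self_eq_norm_sq, hn, T.norm_normal F, one_pow]
  set a := inner ℝ n (x - y) with ha
  obtain ⟨ρ, hρ, hball⟩ := hx.2
  -- `z s` is the point where the ray from `y` through `x + s n` hits the hyperplane of the face
  let z : ℝ → E d := fun s => y + (a / (a + s)) • (x + s • n - y)
  have hz : ContinuousAt z 0 := by
    have : a + 0 ≠ 0 := by linarith
    fun_prop (disch := assumption)
  have hz0 : z 0 = x := by simp [z, hlt.ne]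
  have h1 : ∀ᶠ s in 𝓝 (0 : ℝ), z s ∈ Metric.ball x ρ := by
    apply hz.eventually_mem
    rw [hz0]
    exact Metric.ball_mem_nhds _ hρ
  have h2 : ∀ᶠ s in 𝓝 (0 : ℝ), s < -a := gt_mem_nhds (by linarith)
  obtain ⟨s, ⟨⟨-, hs3⟩, hs1, hs2⟩, hs0⟩ := (((T.outward F x hx).and
    ((h1.and h2).filter_mono nhdsWithin_le_nhds)).and self_mem_nhdsWithin).exists
  have hs0 : 0 < s := hs0
  have has : a + s < 0 := by linarith
  apply hs3
  have hin : inner ℝ n (x + s • n - y) = a + s := by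
    rw [add_sub_right_comm, inner_add_right, inner_smul_right, hnn, mul_one]
  have hzF : z s ∈ F.1 := by
    apply hball _ hs1
    have : z s - x = (a / (a + s)) • (x + s • n - y) - (x - y) := by simp only [z]; abel
    rw [this, inner_sub_right, inner_smul_right, hin, div_mul_cancel₀ _ has.ne, ← ha, sub_self]
  have hm := hB.mem_of_mem_closure hy (T.face_subset_closure F hzF) (t := (a + s) / a)
    (div_nonneg_of_nonpos has.le hlt.le) ((div_lt_one_of_neg hlt).2 (by linarith))
  have e : (a + s) / a * (a / (a + s)) = 1 := by
    have := has.ne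
    have := hlt.ne
    field_simp
  rw [show z s - y = (a / (a + s)) • (x + s • n - y) by simp [z], smul_smul, e, one_smul] at hm
  exact subset_closure (by simpa using hm)

/-- The weak inequality also holds at the vertex `y + s n`, still in the ball for small `s > 0`;
this leaves a margin `s` at `y`. Planarity carries it to all of `F`. -/
theorem IsStarBall.inner_pos (hB : T.IsStarBall x₀ r) (hy : y ∈ Metric.ball x₀ r) (F : T.Face)
    {p : E d} (hp : p ∈ F.1) : 0 < inner ℝ (T.normal F) (p - y) := by
  obtain ⟨x, hx⟩ := T.relInterior_nonempty F
  have hnn : inner ℝ (T.normal F) (T.normal F) = 1 := by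
    rw [real_inner_self_eq_norm_sq, T.norm_normal F, one_pow]
  have hev : ∀ᶠ s in 𝓝 (0 : ℝ), y + s • T.normal F ∈ Metric.ball x₀ r := by
    have hc : ContinuousAt (fun s : ℝ => y + s • T.normal F) 0 := by fun_prop
    apply hc.eventually_mem
    simpa using Metric.isOpen_ball.mem_nhds hy
  obtain ⟨s, hs, hs0⟩ :=
    ((hev.filter_mono nhdsWithin_le_nhds).and (self_mem_nhdsWithin (s := Ioi (0 : ℝ)))).exists
  have hs0 : 0 < s := hs0
  have h1 := hB.inner_nonneg_of_mem_relInterior hs F hx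
  have h2 := T.planar F x hx.1 p hp
  rw [← sub_sub, inner_sub_right, inner_smul_right, hnn] at h1
  have h3 : p - y = (p - x) + (x - y) := by abel
  rw [h3, inner_add_right, h2]
  linarith

/-- The distance from `y` to the hyperplane of `F`. -/
def height (T : MeshCell d) (y : E d) (F : T.Face) : ℝ :=
  inner ℝ (T.normal F) ((T.relInterior_nonempty F).some - y)

theorem inner_eq_height (F : T.Face) {p : E d} (hp : p ∈ F.1) :
    inner ℝ (T.normal F) (p - y) = T.height y F := by
  have h2 := T.planar F _ (T.relInterior_nonempty F).some_mem.1 p hp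
  have h3 : p - y = (p - (T.relInterior_nonempty F).some) +
    ((T.relInterior_nonempty F).some - y) := by abel
  rw [h3, inner_add_right, h2, zero_add, height]

theorem IsStarBall.height_pos (hB : T.IsStarBall x₀ r) (hy : y ∈ Metric.ball x₀ r) (F : T.Face) :
    0 < T.height y F :=
  hB.inner_pos hy F (T.relInterior_nonempty F).some_mem.1

/-! ### Decomposition of a cell into cones over its faces -/

theorem IsStarBall.cone_subset (hB : T.IsStarBall x₀ r) (hy : y ∈ Metric.ball x₀ r)
    {A : Set (E d)} (hA : A ⊆ closure T.carrier) : cone y A ⊆ T.carrier := by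
  rintro _ ⟨t, ht, p, hp, rfl⟩
  exact hB.mem_of_mem_closure hy (hA hp) ht.1.le ht.2

/-- The ray from `y` continued beyond `x` leaves the bounded cell, so by connectedness it meets the
boundary, hence a face. -/
theorem exists_mem_cone {x : E d} (hx : x ∈ T.carrier) (hxy : x ≠ y) : ∃ F : T.Face, x ∈ cone y F.1 := by
  have hne : 0 < ‖x - y‖ := norm_pos_iff.2 (sub_ne_zero.2 hxy)
  obtain ⟨R, hR⟩ := T.isBounded.subset_ball y
  let γ : ℝ → E d := fun s => y + s • (x - y)
  have hγ : Continuous γ := by fun_prop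
  have hpre : IsPreconnected (γ '' Ici 1) := isPreconnected_Ici.image _ hγ.continuousOn
  obtain ⟨q, ⟨s, hs, rfl⟩, hq⟩ : (γ '' Ici 1 ∩ frontier T.carrier).Nonempty := by
    by_contra! hemp
    have hcl : γ '' Ici 1 ⊆ T.carrier := by
      refine hpre.subset_left_of_subset_union T.isOpen isClosed_closure.isOpen_compl
        (disjoint_compl_right_iff_subset.2 subset_closure) (fun q hq => ?_)
        ⟨x, ⟨1, mem_Ici.2 le_rfl, by simp [γ]⟩, hx⟩
      by_contra hn
      rw [mem_union, not_or, notMem_compl_iff] at hn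
      have : q ∈ γ '' Ici 1 ∩ frontier T.carrier := ⟨hq, by
        rw [T.isOpen.frontier_eq]
        exact ⟨hn.2, hn.1⟩⟩
      rw [hemp] at this
      exact this
    -- At this parameter the ray is at distance at least `R` from `y`, outside the ball that
    -- contains the cell.
    have hmem := hR (hcl ⟨max 1 (R / ‖x - y‖), mem_Ici.2 (le_max_left _ _), rfl⟩)
    have hpos : 0 ≤ max 1 (R / ‖x - y‖) := zero_le_one.trans (le_max_left _ _)
    rw [mem_ball_iff_norm, show γ (max 1 (R / ‖x - y‖)) - y = max 1 (R / ‖x - y‖) • (x - y) by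
      simp [γ], norm_smul, Real.norm_of_nonneg hpos] at hmem
    have : R ≤ max 1 (R / ‖x - y‖) * ‖x - y‖ := by
      rw [← div_le_iff₀ hne]
      exact le_max_right _ _
    linarith
  have hs1 : 1 < s := by
    refine lt_of_le_of_ne hs ?_
    rintro rfl
    exact T.notMem_of_mem_frontier hq (by simpa [γ] using hx)
  rw [T.frontier_eq] at hq
  obtain ⟨F, hF, hqF⟩ := mem_iUnion₂.1 hq
  refine ⟨⟨F, hF⟩, s⁻¹, ⟨by positivity, inv_lt_one_of_one_lt₀ hs1⟩, _, hqF, ?_⟩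
  have : s⁻¹ * s = 1 := inv_mul_cancel₀ (by positivity)
  simp [γ, smul_smul, this]

/-- A ray from `y` meets the boundary only once: of two such points the nearer would be in the open
cell. -/
theorem IsStarBall.eq_of_mem_frontier (hB : T.IsStarBall x₀ r) (hy : y ∈ Metric.ball x₀ r)
    {p q : E d} (hp : p ∈ frontier T.carrier) (hq : q ∈ frontier T.carrier) {s t : ℝ}
    (hs : 0 < s) (ht : 0 < t) (h : y + s • (p - y) = y + t • (q - y)) : p = q := by
  have aux : ∀ {p q : E d} {s t : ℝ}, p ∈ frontier T.carrier → q ∈ frontier T.carrier →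
      0 < s → 0 < t → y + s • (p - y) = y + t • (q - y) → s ≤ t := by
    intro p q s t hp hq hs ht h
    by_contra! hlt
    apply T.notMem_of_mem_frontier hp
    have := hB.mem_of_mem_closure hy (frontier_subset_closure hq) (t := t / s)
      (by positivity) ((div_lt_one hs).2 hlt)
    convert this using 1
    rw [div_eq_inv_mul, mul_smul, ← add_left_cancel h, smul_smul, inv_mul_cancel₀ hs.ne', one_smul]
    abel
  obtain rfl : s = t := le_antisymm (aux hp hq hs ht h) (aux hq hp ht hs h.symm)
  simpa using smul_right_injective (E d) hs.ne' (add_left_cancel h)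

theorem IsStarBall.cone_inter_cone_subset (hB : T.IsStarBall x₀ r) (hy : y ∈ Metric.ball x₀ r)
    (F F' : T.Face) : cone y F.1 ∩ cone y F'.1 ⊆ cone y (F.1 ∩ F'.1) := by
  rintro _ ⟨⟨s, hs, p, hp, rfl⟩, t, ht, q, hq, h⟩
  obtain rfl := hB.eq_of_mem_frontier hy (T.face_subset_frontier F hp)
    (T.face_subset_frontier F' hq) hs.1 ht.1 h
  exact ⟨s, hs, p, ⟨hp, hq⟩, rfl⟩

/-- Two cones overlap only in the cone over the common part of their faces, whose surface measure is
zero. -/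
theorem IsStarBall.aedisjoint_cone (hB : T.IsStarBall x₀ r) (hy : y ∈ Metric.ball x₀ r) :
    Pairwise (Function.onFun (AEDisjoint (volume : Measure (E d))) fun F : T.Face => cone y F.1) := by
  intro F F' hne
  have hm : MeasurableSet (F.1 ∩ F'.1) :=
    (T.isClosed_face _ F.2).measurableSet.inter (T.isClosed_face _ F'.2).measurableSet
  refine measure_mono_null (hB.cone_inter_cone_subset hy F F') ?_
  have hv := volume_inter_cone (T.norm_normal F) (hB.height_pos hy F)
    (A := F.1 ∩ F'.1) (fun p hp => inner_eq_height F hp.1) hm MeasurableSet.univ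
  rw [univ_inter] at hv
  rw [hv]
  have h0 := T.null_overlap F.1 F.2 F'.1 F'.2 (fun h => hne (Subtype.ext h))
  simp [h0]

theorem IsStarBall.integral_eq_sum_cone (hd : 1 ≤ d) (hB : T.IsStarBall x₀ r)
    (hy : y ∈ Metric.ball x₀ r) {G : E d → ℝ} (hG : IntegrableOn G T.carrier) :
    ∫ x in T.carrier, G x = ∑ F : T.Face, ∫ x in cone y F.1, G x := by
  -- Positive dimension makes the vertex, which the cones miss, a null set.
  have : Nonempty (Fin d) := ⟨⟨0, hd⟩⟩
  have hsub : ⋃ F : T.Face, cone y F.1 ⊆ T.carrier :=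
    iUnion_subset fun F => hB.cone_subset hy (T.face_subset_closure F)
  have hae : T.carrier =ᵐ[volume] ⋃ F : T.Face, cone y F.1 := by
    refine EventuallyLE.antisymm ?_ (Eventually.of_forall hsub)
    filter_upwards [compl_mem_ae_iff.2 (measure_singleton (μ := volume) y)] with x hxy hx
    exact mem_iUnion.2 (exists_mem_cone hx hxy)
  rw [setIntegral_congr_set hae, integral_iUnion_ae (fun F => (measurableSet_cone
    (hB.height_pos hy F) (fun p hp => inner_eq_height F hp)
    (T.isClosed_face _ F.2).measurableSet).nullMeasurableSet) (hB.aedisjoint_cone hy)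
    (hG.mono_set hsub), tsum_fintype]

end MeshCell
end HHO

end

noncomputable section

namespace HHO
namespace MeshCell

variable {d : ℕ} (T : MeshCell d)

/-! ### The divergence theorem for smooth functions -/

instance : IsFiniteMeasure T.vol := ⟨by simpa using T.isBounded.measure_lt_top⟩

instance (F : T.Face) : IsFiniteMeasure (T.surf F) := ⟨by simpa using T.surf_lt_top F⟩

theorem memLp_vol {f : E d → ℝ} (hf : Continuous f) : MemLp f 2 T.vol :=
  memLp_of_isBounded T.isBounded T.isOpen.measurableSet T.isBounded.measure_lt_top hf

theorem memLp_surf (F : T.Face) {f : E d → ℝ} (hf : Continuous f) : MemLp f 2 (T.surf F) :=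
  memLp_of_isBounded (T.isBounded_face F) (T.isClosed_face F.1 F.2).measurableSet
    (T.surf_lt_top F) hf

theorem integrable_vol {f : E d → ℝ} (hf : Continuous f) : Integrable f T.vol :=
  (T.memLp_vol hf).integrable (by norm_num)

theorem integrable_surf (F : T.Face) {f : E d → ℝ} (hf : Continuous f) :
    Integrable f (T.surf F) :=
  (T.memLp_surf F hf).integrable (by norm_num)

variable {T} {x₀ y : E d} {r : ℝ}

/-- The divergence theorem for the field `φ (x - y)`: it is tangent to the lateral sides of the
cones, so only the faces contribute, each with constant normal component `height`. -/
theorem IsStarBall.integral_radial (hd : 1 ≤ d) (hB : T.IsStarBall x₀ r)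
    (hy : y ∈ Metric.ball x₀ r) {φ : E d → ℝ} (hφ : ContDiff ℝ 1 φ) :
    ∫ x in T.carrier, (d * φ x + fderiv ℝ φ x (x - y)) =
      ∑ F : T.Face, ∫ p, φ p * T.height y F ∂(T.surf F) := by
  have hG : Continuous fun x => d * φ x + fderiv ℝ φ x (x - y) :=
    (continuous_const.mul hφ.continuous).add
      ((hφ.continuous_fderiv (by simp)).clm_apply (by fun_prop))
  have hi : IntegrableOn (fun x => d * φ x + fderiv ℝ φ x (x - y)) T.carrier := T.integrable_vol hG
  rw [hB.integral_eq_sum_cone hd hy hi]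
  refine Finset.sum_congr rfl fun F _ => ?_
  exact integral_cone_radial hd (T.norm_normal F) (hB.height_pos hy F)
    (fun p hp => inner_eq_height F hp) (T.isClosed_face F.1 F.2).measurableSet (T.surf_lt_top F) hφ
    (hi.mono_set (hB.cone_subset hy (T.face_subset_closure F)))

variable (T)

/-- The constant direction is a difference of radial ones: `c e = (x - (x₀ - c e)) - (x - x₀)`, with
`c > 0` so small that both vertices lie in the star ball. -/
theorem integral_fderiv_apply (hd : 1 ≤ d) {φ : E d → ℝ} (hφ : ContDiff ℝ 1 φ) (e : E d) :
    ∫ x in T.carrier, fderiv ℝ φ x e =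
      ∑ F : T.Face, ∫ p, φ p * inner ℝ (T.normal F) e ∂(T.surf F) := by
  obtain ⟨x₀, r, hB⟩ := T.exists_isStarBall
  have hx₀ : x₀ ∈ Metric.ball x₀ r := Metric.mem_ball_self hB.1
  have hev : ∀ᶠ s in 𝓝 (0 : ℝ), x₀ - s • e ∈ Metric.ball x₀ r := by
    have hc : ContinuousAt (fun s : ℝ => x₀ - s • e) 0 := by fun_prop
    apply hc.eventually_mem
    simpa using Metric.ball_mem_nhds _ hB.1
  obtain ⟨c, hc, hc0⟩ :=
    ((hev.filter_mono nhdsWithin_le_nhds).and (self_mem_nhdsWithin (s := Ioi (0 : ℝ)))).exists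
  have hc0 : 0 < c := hc0
  have h1 := hB.integral_radial hd hx₀ hφ
  have h2 := hB.integral_radial hd hc hφ
  have hD := hφ.continuous_fderiv (by simp)
  have hφc := hφ.continuous
  have e1 : ∀ x, d * φ x + fderiv ℝ φ x (x - (x₀ - c • e)) =
      (d * φ x + fderiv ℝ φ x (x - x₀)) + c * fderiv ℝ φ x e := by
    intro x
    rw [← smul_eq_mul c, ← map_smul, add_assoc, ← map_add]
    congr 3
    abel
  have e2 : ∀ F : T.Face, ∀ p, φ p * T.height (x₀ - c • e) F =
      φ p * T.height x₀ F + c * (φ p * inner ℝ (T.normal F) e) := by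
    intro F p
    rw [height, ← sub_add, inner_add_right, inner_smul_right, height]
    ring
  have i1 : Integrable (fun x => d * φ x + fderiv ℝ φ x (x - x₀)) T.vol :=
    T.integrable_vol ((continuous_const.mul hφc).add (hD.clm_apply (by fun_prop)))
  have i2 : Integrable (fun x => c * fderiv ℝ φ x e) T.vol :=
    T.integrable_vol (continuous_const.mul (hD.clm_apply continuous_const))
  simp_rw [e1, e2] at h2
  have i3 : ∀ F : T.Face, ∫ p, (φ p * T.height x₀ F + c * (φ p * inner ℝ (T.normal F) e)) ∂T.surf F
      = ∫ p, φ p * T.height x₀ F ∂T.surf F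
        + c * ∫ p, φ p * inner ℝ (T.normal F) e ∂T.surf F := by
    intro F
    rw [integral_add (T.integrable_surf F (by fun_prop)) (T.integrable_surf F (by fun_prop)),
      integral_const_mul]
  simp_rw [i3] at h2
  rw [integral_add i1 i2, h1, Finset.sum_add_distrib, ← Finset.mul_sum, integral_const_mul] at h2
  exact mul_left_cancel₀ hc0.ne' (add_left_cancel h2)

theorem integral_partialDeriv (hd : 1 ≤ d) {φ : E d → ℝ} (hφ : ContDiff ℝ 1 φ) (i : Fin d) :
    ∫ x in T.carrier, partialDeriv i φ x = ∑ F : T.Face, ∫ p, φ p * T.normal F i ∂(T.surf F) := by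
  simpa [partialDeriv, EuclideanSpace.inner_single_right] using
    T.integral_fderiv_apply hd hφ (EuclideanSpace.single i 1)

/-! ### The trace inequality -/

theorem fderiv_apply_eq_sum (φ : E d → ℝ) (x v : E d) :
    fderiv ℝ φ x v = ∑ i, v i * partialDeriv i φ x := by
  have hv : v = ∑ i, v i • EuclideanSpace.single i (1 : ℝ) := by
    simpa using ((EuclideanSpace.basisFun (Fin d) ℝ).sum_repr v).symm
  conv_lhs => rw [hv, map_sum]
  simp [partialDeriv]

theorem continuous_partialDeriv_of_contDiff_one {φ : E d → ℝ} (hφ : ContDiff ℝ 1 φ) (i : Fin d) :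
    Continuous (partialDeriv i φ) :=
  (hφ.continuous_fderiv (by simp)).clm_apply continuous_const

/-- The radial identity for `φ²` has only nonnegative face terms, so the volume integral bounds each
one; Young's inequality bounds the volume integrand. -/
theorem exists_integral_sq_le (hd : 1 ≤ d) (F : T.Face) : ∃ C : ℝ, 0 ≤ C ∧
    ∀ φ : E d → ℝ, ContDiff ℝ 1 φ → ∫ p, φ p ^ 2 ∂(T.surf F) ≤
      C * ((∫ x in T.carrier, φ x ^ 2) + ∑ i, ∫ x in T.carrier, partialDeriv i φ x ^ 2) := by
  obtain ⟨x₀, r, hB⟩ := T.exists_isStarBall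
  have hx₀ : x₀ ∈ Metric.ball x₀ r := Metric.mem_ball_self hB.1
  obtain ⟨R, hR⟩ := T.isBounded.subset_ball x₀
  have hR0 : 0 < R := Metric.pos_of_mem_ball (hR (hB.mem_carrier hx₀))
  have hh := hB.height_pos hx₀ F
  -- Young's inequality leaves `(d + R d) φ² + R ∑ (∂ᵢφ)²`, and both coefficients are at most `(R +
  -- 1)(d + 1)`.
  refine ⟨(R + 1) * (d + 1) / T.height x₀ F, by positivity, fun φ hφ => ?_⟩
  have hφc := hφ.continuous
  have hDc := fun i => continuous_partialDeriv_of_contDiff_one hφ i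
  have h1 := hB.integral_radial hd hx₀ (hφ.pow 2)
  have h2 : ∫ p, φ p ^ 2 * T.height x₀ F ∂T.surf F ≤
      ∑ F : T.Face, ∫ p, φ p ^ 2 * T.height x₀ F ∂T.surf F :=
    Finset.single_le_sum (f := fun F : T.Face => ∫ p, φ p ^ 2 * T.height x₀ F ∂T.surf F)
      (fun F' _ => integral_nonneg fun p => mul_nonneg (sq_nonneg _) (hB.height_pos hx₀ F').le)
      (Finset.mem_univ F)
  rw [← h1, integral_mul_const] at h2
  have hfd : ∀ x, fderiv ℝ (fun x => φ x ^ 2) x (x - x₀) =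
      2 * φ x * ∑ i, (x - x₀) i * partialDeriv i φ x := by
    intro x
    rw [← fderiv_apply_eq_sum, fderiv_fun_pow _ (hφ.differentiable (by simp) x)]
    simp [mul_assoc]
  have h3 : ∫ x in T.carrier, (d * φ x ^ 2 + fderiv ℝ (fun x => φ x ^ 2) x (x - x₀)) ≤
      ∫ x in T.carrier, (R + 1) * (d + 1) * (φ x ^ 2 + ∑ i, partialDeriv i φ x ^ 2) := by
    refine setIntegral_mono_on ?_ ?_ T.isOpen.measurableSet fun x hx => ?_
    · exact T.integrable_vol ((continuous_const.mul (hφc.pow 2)).add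
        (((hφ.pow 2).continuous_fderiv (by simp)).clm_apply (by fun_prop)))
    · exact T.integrable_vol (continuous_const.mul ((hφc.pow 2).add
        (continuous_finsetSum _ fun i _ => (hDc i).pow 2)))
    rw [hfd, Finset.mul_sum]
    have hxR : ‖x - x₀‖ ≤ R := (mem_ball_iff_norm.1 (hR hx)).le
    have hle : ∑ i, 2 * φ x * ((x - x₀) i * partialDeriv i φ x) ≤
        ∑ i, R * (φ x ^ 2 + partialDeriv i φ x ^ 2) := by
      refine Finset.sum_le_sum fun i _ => ?_
      have hi : |(x - x₀) i| ≤ R := (PiLp.norm_apply_le (x - x₀) i).trans hxR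
      obtain ⟨ha, hb⟩ := abs_le.1 hi
      generalize (x - x₀) i = a at *
      generalize partialDeriv i φ x = b at *
      -- `R (φ² + b²) - 2 a φ b` is half of `(R - a)(φ + b)² + (R + a)(φ - b)²`.
      nlinarith [mul_nonneg (sub_nonneg.2 hb) (sq_nonneg (φ x + b)),
        mul_nonneg (sub_nonneg.2 hb) (sq_nonneg (φ x - b)),
        mul_nonneg (by linarith : 0 ≤ R + a) (sq_nonneg (φ x - b)),
        mul_nonneg (by linarith : 0 ≤ R + a) (sq_nonneg (φ x + b))]
    have hsum : ∑ i, R * (φ x ^ 2 + partialDeriv i φ x ^ 2) =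
        R * (d * φ x ^ 2 + ∑ i, partialDeriv i φ x ^ 2) := by
      rw [← Finset.mul_sum, Finset.sum_add_distrib, Finset.sum_const, Finset.card_univ,
        Fintype.card_fin, nsmul_eq_mul]
    rw [hsum] at hle
    have hS : 0 ≤ ∑ i, partialDeriv i φ x ^ 2 := Finset.sum_nonneg fun i _ => sq_nonneg _
    have hd0 : (0 : ℝ) ≤ d := Nat.cast_nonneg d
    nlinarith [sq_nonneg (φ x), mul_nonneg hR0.le hS, mul_nonneg hd0 hS,
      mul_nonneg (mul_nonneg hR0.le hd0) hS, mul_nonneg hR0.le (sq_nonneg (φ x))]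
  have h4 := h2.trans h3
  rw [integral_const_mul, integral_add (f := fun x => φ x ^ 2)
    (g := fun x => ∑ i, partialDeriv i φ x ^ 2) (T.integrable_vol (hφc.pow 2))
    (T.integrable_vol (continuous_finsetSum _ fun i _ => (hDc i).pow 2)), integral_finsetSum
    (f := fun i x => partialDeriv i φ x ^ 2) _ (fun i _ => T.integrable_vol ((hDc i).pow 2))] at h4
  rw [div_mul_eq_mul_div, le_div_iff₀ hh]
  exact h4

theorem eLpNorm_two_eq_ofReal_sqrt {μ : Measure (E d)} {f : E d → ℝ} (hf : MemLp f 2 μ) :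
    eLpNorm f 2 μ = ENNReal.ofReal √(∫ x, f x ^ 2 ∂μ) := by
  rw [hf.eLpNorm_eq_integral_rpow_norm (by norm_num) (by norm_num), Real.sqrt_eq_rpow]
  simp

theorem exists_eLpNorm_surf_le (hd : 1 ≤ d) (F : T.Face) : ∃ C : ℝ,
    ∀ φ : E d → ℝ, ContDiff ℝ 1 φ → eLpNorm φ 2 (T.surf F) ≤
      ENNReal.ofReal C * (eLpNorm φ 2 T.vol + ∑ i, eLpNorm (partialDeriv i φ) 2 T.vol) := by
  obtain ⟨C, hC, h⟩ := T.exists_integral_sq_le hd F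
  refine ⟨√C, fun φ hφ => ?_⟩
  rw [eLpNorm_two_eq_ofReal_sqrt (T.memLp_surf F hφ.continuous),
    eLpNorm_two_eq_ofReal_sqrt (T.memLp_vol hφ.continuous)]
  simp_rw [fun i => eLpNorm_two_eq_ofReal_sqrt
    (T.memLp_vol (continuous_partialDeriv_of_contDiff_one hφ i))]
  have hn : ∀ i, 0 ≤ √(∫ x in T.carrier, partialDeriv i φ x ^ 2) := fun i => Real.sqrt_nonneg _
  rw [← ENNReal.ofReal_sum_of_nonneg fun i _ => hn i, ← ENNReal.ofReal_add (Real.sqrt_nonneg _)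
    (Finset.sum_nonneg fun i _ => hn i), ← ENNReal.ofReal_mul (Real.sqrt_nonneg _)]
  apply ENNReal.ofReal_le_ofReal
  refine (Real.sqrt_le_sqrt (h φ hφ)).trans ?_
  rw [Real.sqrt_mul hC]
  refine mul_le_mul_of_nonneg_left ?_ (Real.sqrt_nonneg _)
  refine Real.sqrt_le_iff.2 ⟨add_nonneg (Real.sqrt_nonneg _) (Finset.sum_nonneg fun i _ => hn i), ?_⟩
  have hs : ∑ i, ∫ x in T.carrier, partialDeriv i φ x ^ 2 ≤
      (∑ i, √(∫ x in T.carrier, partialDeriv i φ x ^ 2)) ^ 2 := by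
    refine le_trans (le_of_eq ?_) (Finset.sum_sq_le_sq_sum_of_nonneg fun i _ => hn i)
    exact Finset.sum_congr rfl fun i _ => (Real.sq_sqrt (integral_nonneg fun x => sq_nonneg _)).symm
  have h0 : √(∫ x in T.carrier, φ x ^ 2) ^ 2 = ∫ x in T.carrier, φ x ^ 2 :=
    Real.sq_sqrt (integral_nonneg fun x => sq_nonneg _)
  nlinarith [mul_nonneg (Real.sqrt_nonneg (∫ x in T.carrier, φ x ^ 2))
    (Finset.sum_nonneg fun i (_ : i ∈ Finset.univ) => hn i)]

end MeshCell
end HHO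

end

noncomputable section

namespace HHO

/-! ### Smoothing by averaged contractions -/

section Smoothing

variable {d : ℕ}

/-- A smooth probability density supported in `U`. -/
structure IsMollifier (η : E d → ℝ) (U : Set (E d)) : Prop where
  contDiff : ContDiff ℝ ∞ η
  hasCompactSupport : HasCompactSupport η
  nonneg : ∀ z, 0 ≤ η z
  integral_eq_one : ∫ z, η z = 1
  tsupport_subset : tsupport η ⊆ U

theorem exists_isMollifier (x₀ : E d) {r : ℝ} (hr : 0 < r) :
    ∃ η : E d → ℝ, IsMollifier η (Metric.ball x₀ r) := by
  let b : ContDiffBump x₀ := ⟨r / 3, r / 2, by positivity, by linarith⟩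
  refine ⟨b.normed volume, b.contDiff_normed, b.hasCompactSupport_normed,
    fun z => b.nonneg_normed z, b.integral_normed, ?_⟩
  rw [b.tsupport_normed_eq]
  exact Metric.closedBall_subset_ball (by change r / 2 < r; linarith)

/-- The average of `f` over the contractions `x ↦ s x + (1 - s) z` with centres `z`,
weighted by `η`. -/
def smoothing (η : E d → ℝ) (s : ℝ) (f : E d → ℝ) (x : E d) : ℝ :=
  ∫ z, η z * f (s • x + (1 - s) • z)

/-- The kernel of `smoothing η s` as a convolution. -/
def smoothingKernel (η : E d → ℝ) (s : ℝ) (u : E d) : ℝ := η (-((1 - s)⁻¹ • u))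

variable {η : E d → ℝ} {U : Set (E d)} {s : ℝ} {f g : E d → ℝ}

theorem IsMollifier.contDiff_smoothingKernel (hη : IsMollifier η U) :
    ContDiff ℝ ∞ (smoothingKernel η s) :=
  hη.contDiff.comp (g := η) (f := fun u => -((1 - s)⁻¹ • u)) (by fun_prop)

theorem IsMollifier.hasCompactSupport_smoothingKernel (hη : IsMollifier η U) (hs : s < 1) :
    HasCompactSupport (smoothingKernel η s) := by
  have hc : -(1 - s)⁻¹ ≠ 0 := neg_ne_zero.2 (inv_ne_zero (by linarith))
  have := hη.hasCompactSupport.comp_smul hc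
  simp only [neg_smul] at this
  exact this

/-- With `v = s x + (1 - s) z` the kernel argument is `-(1 - s) z`, which explains the sign in
`smoothingKernel`. After the change of variables, smoothing is a scaled convolution evaluated at `s
x`. -/
theorem smoothing_eq_comp (hs : s < 1) (x : E d) :
    smoothing η s f x = ∫ z, (fun v => smoothingKernel η s (s • x - v) * f v)
      (s • x + (1 - s) • z) := by
  have h1 : (1 - s) ≠ 0 := by linarith
  simp only [smoothing, smoothingKernel]
  congr with z
  rw [sub_add_cancel_left, smul_neg, neg_neg, smul_smul, inv_mul_cancel₀ h1, one_smul]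

theorem smoothing_eq_integral (hs : s < 1) (x : E d) :
    smoothing η s f x = |((1 - s) ^ d)⁻¹| * ∫ v, smoothingKernel η s (s • x - v) * f v := by
  rw [smoothing_eq_comp hs]
  have := Measure.integral_comp_smul (volume : Measure (E d))
    (fun w => (fun v => smoothingKernel η s (s • x - v) * f v) (s • x + w)) (1 - s)
  rw [finrank_euclideanSpace_fin, smul_eq_mul] at this
  rw [this, integral_add_left_eq_self (fun v => smoothingKernel η s (s • x - v) * f v)]

theorem IsMollifier.memLp_smoothingKernel_comp (hη : IsMollifier η U) (hs : s < 1) (p : E d) :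
    MemLp (fun v => smoothingKernel η s (p - v)) 2 := by
  have h1 : Continuous fun v => smoothingKernel η s (p - v) :=
    hη.contDiff_smoothingKernel.continuous.comp (by fun_prop)
  exact h1.memLp_of_hasCompactSupport
    ((hη.hasCompactSupport_smoothingKernel hs).comp_homeomorph (Homeomorph.subLeft p))

theorem IsMollifier.integrable_smoothing (hη : IsMollifier η U) (hs : s < 1)
    (hf : MemLp f 2) (x : E d) :
    Integrable fun z => η z * f (s • x + (1 - s) • z) := by
  have h1 : (1 - s) ≠ 0 := by linarith
  have h2 : Integrable fun v => smoothingKernel η s (s • x - v) * f v :=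
    (hη.memLp_smoothingKernel_comp hs _).integrable_mul hf
  have h3 := (h2.comp_add_left (s • x)).comp_smul h1
  refine h3.congr (Eventually.of_forall fun z => ?_)
  simp only [smoothingKernel]
  rw [sub_add_cancel_left, smul_neg, neg_neg, smul_smul, inv_mul_cancel₀ h1, one_smul]

theorem smoothing_eq_convolution (hs : s < 1) : smoothing η s f = fun x =>
    |((1 - s) ^ d)⁻¹| * convolution f (smoothingKernel η s) (ContinuousLinearMap.mul ℝ ℝ) volume
      (s • x) := by
  ext x
  rw [smoothing_eq_integral hs, convolution_def]
  simp [mul_comm]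

theorem IsMollifier.contDiff_smoothing (hη : IsMollifier η U) (hs : s < 1) (hf : MemLp f 2) :
    ContDiff ℝ ∞ (smoothing η s f) := by
  rw [smoothing_eq_convolution hs]
  have h := (hη.hasCompactSupport_smoothingKernel hs).contDiff_convolution_right
    (ContinuousLinearMap.mul ℝ ℝ) (μ := volume) (hf.locallyIntegrable (by norm_num))
    (hη.contDiff_smoothingKernel (s := s))
  exact contDiff_const.mul (h.comp (f := fun x : E d => s • x) (by fun_prop))

/-- The derivative is moved onto the kernel as a function of the integration variable, the form
needed to test a weak derivative. The dilation produces `s`, the change of variable the sign. -/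
theorem IsMollifier.partialDeriv_smoothing (hη : IsMollifier η U) (hs : s < 1) (hf : MemLp f 2)
    (i : Fin d) (x : E d) :
    partialDeriv i (smoothing η s f) x = -(s * (|((1 - s) ^ d)⁻¹| *
      ∫ v, f v * partialDeriv i (fun u => smoothingKernel η s (s • x - u)) v)) := by
  have hκ : ContDiff ℝ ∞ (smoothingKernel η s) := hη.contDiff_smoothingKernel
  have hκc := hη.hasCompactSupport_smoothingKernel hs
  have hli : LocallyIntegrable f := hf.locallyIntegrable (by norm_num)
  have h := hκc.hasFDerivAt_convolution_right (ContinuousLinearMap.mul ℝ ℝ) (μ := volume) hli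
    (hκ.of_le (by norm_cast)) (s • x)
  have hl : HasFDerivAt (fun x : E d => s • x) (s • ContinuousLinearMap.id ℝ (E d)) x :=
    (hasFDerivAt_id x).const_smul s
  have h2 := (h.comp x hl).const_mul |((1 - s) ^ d)⁻¹|
  have e := smoothing_eq_convolution (η := η) (f := f) hs
  rw [partialDeriv, e]
  have h3 := h2.fderiv
  simp only [Function.comp_def] at h3
  rw [h3]
  simp only [smul_apply, ContinuousLinearMap.comp_apply,
    ContinuousLinearMap.id_apply, map_smul, smul_eq_mul]
  rw [convolution_precompR_apply _ hli (hκc.fderiv ℝ)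
    (hκ.continuous_fderiv (by simp)), convolution_def]
  have hd : ∀ v, partialDeriv i (fun u => smoothingKernel η s (s • x - u)) v =
      -fderiv ℝ (smoothingKernel η s) (s • x - v) (EuclideanSpace.single i 1) := by
    intro v
    have hk := (hκ.differentiable (by simp) (s • x - v)).hasFDerivAt
    have hs := (hasFDerivAt_id (𝕜 := ℝ) v).const_sub (s • x)
    have hh := (hk.comp v hs).fderiv
    simp only [Function.comp_def] at hh
    rw [partialDeriv, hh]
    simp
  simp_rw [hd]
  simp only [ContinuousLinearMap.mul_apply', mul_neg, integral_neg, neg_neg]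
  ring

/-- The probability measure with density `η`. -/
def densityMeasure (η : E d → ℝ) : Measure (E d) :=
  volume.withDensity fun z => ENNReal.ofReal (η z)

theorem IsMollifier.isProbabilityMeasure (hη : IsMollifier η U) :
    IsProbabilityMeasure (densityMeasure η) := by
  refine ⟨?_⟩
  rw [densityMeasure, withDensity_apply _ MeasurableSet.univ, Measure.restrict_univ,
    ← ofReal_integral_eq_lintegral_ofReal (hη.contDiff.continuous.integrable_of_hasCompactSupport
      hη.hasCompactSupport) (Eventually.of_forall hη.nonneg), hη.integral_eq_one,
    ENNReal.ofReal_one]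

theorem lintegral_comp_smul_add (hs : 0 < s) {h : E d → ENNReal} (hh : Measurable h) (c : E d) :
    ∫⁻ x, h (s • x + c) = ENNReal.ofReal ((s ^ d)⁻¹) * ∫⁻ x, h x := by
  have hm : Measurable fun x : E d => s • x := by fun_prop
  have h1 : Measurable fun u : E d => h (u + c) := hh.comp (by fun_prop)
  rw [← lintegral_map h1 hm, Measure.map_addHaar_smul _ hs.ne', lintegral_smul_measure,
    lintegral_add_right_eq_self h, finrank_euclideanSpace_fin, abs_of_pos (by positivity),
    smul_eq_mul]

theorem eLpNorm_two_rpow_eq_lintegral (f : E d → ℝ) (μ : Measure (E d)) :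
    eLpNorm f 2 μ ^ (2 : ℝ) = ∫⁻ x, ‖f x‖ₑ ^ (2 : ℝ) ∂μ :=
  eLpNorm_nnreal_pow_eq_lintegral (p := 2) (by norm_num)

/-- Jensen's inequality, as `L¹ ≤ L²` for the probability measure with density `η`. -/
theorem IsMollifier.enorm_smoothing_sq_le (hη : IsMollifier η U) (hf : Measurable f) (x : E d) :
    ‖smoothing η s f x‖ₑ ^ (2 : ℝ) ≤
      ∫⁻ z, ‖f (s • x + (1 - s) • z)‖ₑ ^ (2 : ℝ) ∂densityMeasure η := by
  have := hη.isProbabilityMeasure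
  have hm : Measurable fun z => f (s • x + (1 - s) • z) := hf.comp (by fun_prop)
  have h1 : ‖smoothing η s f x‖ₑ ≤ eLpNorm (fun z => f (s • x + (1 - s) • z)) 1
      (densityMeasure η) := by
    rw [eLpNorm_one_eq_lintegral_enorm, densityMeasure, lintegral_withDensity_eq_lintegral_mul _
      (by have := hη.contDiff.continuous; fun_prop) hm.enorm]
    refine (enorm_integral_le_lintegral_enorm _).trans (le_of_eq (lintegral_congr fun z => ?_))
    rw [enorm_mul, Real.enorm_eq_ofReal (hη.nonneg z)]
    rfl
  have h2 : eLpNorm (fun z => f (s • x + (1 - s) • z)) 1 (densityMeasure η) ≤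
      eLpNorm (fun z => f (s • x + (1 - s) • z)) 2 (densityMeasure η) :=
    eLpNorm_le_eLpNorm_of_exponent_le (by norm_num) hm.aestronglyMeasurable
  refine (ENNReal.rpow_le_rpow (h1.trans h2) (by norm_num)).trans (le_of_eq ?_)
  exact eLpNorm_two_rpow_eq_lintegral _ _

/-- After Tonelli each contraction costs `s ^ (-d)`; keeping `s` at least `1 / 2` makes the bound
uniform as `s → 1`. -/
theorem IsMollifier.eLpNorm_smoothing_le (hη : IsMollifier η U) (hs : 1 / 2 ≤ s)
    (hf : Measurable f) :
    eLpNorm (smoothing η s f) 2 volume ≤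
      ENNReal.ofReal (2 ^ d) ^ (2 : ℝ)⁻¹ * eLpNorm f 2 volume := by
  have := hη.isProbabilityMeasure
  have hs0 : 0 < s := by linarith
  have hpow : ∀ h : E d → ℝ, eLpNorm h 2 volume ^ (2 : ℝ) = ∫⁻ x, ‖h x‖ₑ ^ (2 : ℝ) := fun h =>
    eLpNorm_two_rpow_eq_lintegral _ _
  have hm : Measurable fun p : E d × E d => ‖f (s • p.1 + (1 - s) • p.2)‖ₑ ^ (2 : ℝ) := by
    have : Measurable fun p : E d × E d => f (s • p.1 + (1 - s) • p.2) := hf.comp (by fun_prop)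
    exact this.enorm.pow_const _
  have hle : (s ^ d)⁻¹ ≤ 2 ^ d := by
    rw [← inv_pow]
    exact pow_le_pow_left₀ (by positivity) ((inv_le_comm₀ hs0 (by norm_num)).2 (by linarith)) d
  rw [← ENNReal.rpow_le_rpow_iff (z := 2) (by norm_num), ENNReal.mul_rpow_of_nonneg _ _ (by norm_num),
    ← ENNReal.rpow_mul, inv_mul_cancel₀ (by norm_num), ENNReal.rpow_one, hpow, hpow]
  calc ∫⁻ x, ‖smoothing η s f x‖ₑ ^ (2 : ℝ)
      ≤ ∫⁻ x, ∫⁻ z, ‖f (s • x + (1 - s) • z)‖ₑ ^ (2 : ℝ) ∂densityMeasure η :=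
        lintegral_mono fun x => hη.enorm_smoothing_sq_le hf x
    _ = ∫⁻ z, ∫⁻ x, ‖f (s • x + (1 - s) • z)‖ₑ ^ (2 : ℝ) ∂volume ∂densityMeasure η :=
        lintegral_lintegral_swap hm.aemeasurable
    _ = ENNReal.ofReal ((s ^ d)⁻¹) * ∫⁻ x, ‖f x‖ₑ ^ (2 : ℝ) := by
        simp_rw [fun z => lintegral_comp_smul_add hs0 (hf.enorm.pow_const (2 : ℝ)) ((1 - s) • z)]
        simp
    _ ≤ _ := by gcongr

theorem IsMollifier.smoothing_sub (hη : IsMollifier η U) (hs : s < 1) (hf : MemLp f 2)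
    (hg : MemLp g 2) (x : E d) :
    smoothing η s (f - g) x = smoothing η s f x - smoothing η s g x := by
  simp only [smoothing]
  rw [← integral_sub (hη.integrable_smoothing hs hf x) (hη.integrable_smoothing hs hg x)]
  simp [mul_sub]

/-- The contraction moves `x` by `(1 - s)(z - x)`, uniformly small for `x ∈ S` and `z` in the
support of `η`; uniform continuity of `g` does the rest. -/
theorem IsMollifier.exists_norm_smoothing_sub_le (hη : IsMollifier η U) (hg : Continuous g)
    (hgc : HasCompactSupport g) {S : Set (E d)} (hS : Bornology.IsBounded S) {ε : ℝ} (hε : 0 < ε) :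
    ∀ᶠ s in 𝓝[<] (1 : ℝ), ∀ x ∈ S, ‖smoothing η s g x - g x‖ ≤ ε := by
  have hunif := hgc.uniformContinuous_of_continuous hg
  obtain ⟨δ, hδ, hδg⟩ := Metric.uniformContinuous_iff.1 hunif ε hε
  obtain ⟨R, hR⟩ := (hS.union hη.hasCompactSupport.isBounded).exists_norm_le
  have hev : ∀ᶠ s in 𝓝[<] (1 : ℝ), |1 - s| * (2 * |R|) < δ := by
    have hc : ContinuousAt (fun s : ℝ => |1 - s| * (2 * |R|)) 1 := by fun_prop
    refine (hc.eventually_lt_const (by simpa using hδ)).filter_mono nhdsWithin_le_nhds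
  filter_upwards [hev, self_mem_nhdsWithin] with s hs hs1 x hx
  have hs1 : s < 1 := hs1
  have hgm : MemLp g 2 := hg.memLp_of_hasCompactSupport hgc
  have hηi : Integrable η := hη.contDiff.continuous.integrable_of_hasCompactSupport
    hη.hasCompactSupport
  have e : smoothing η s g x - g x = ∫ z, (η z * g (s • x + (1 - s) • z) - η z * g x) := by
    rw [integral_sub (hη.integrable_smoothing hs1 hgm x) (hηi.mul_const _), integral_mul_const,
      hη.integral_eq_one, one_mul, smoothing]
  rw [e]
  have hb : ∀ z, ‖η z * g (s • x + (1 - s) • z) - η z * g x‖ ≤ η z * ε := by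
    intro z
    rw [← mul_sub, norm_mul, Real.norm_of_nonneg (hη.nonneg z)]
    by_cases hz : z ∈ tsupport η
    · refine mul_le_mul_of_nonneg_left ?_ (hη.nonneg z)
      rw [← dist_eq_norm]
      refine (hδg ?_).le
      rw [dist_eq_norm]
      have : s • x + (1 - s) • z - x = (1 - s) • (z - x) := by module
      rw [this, norm_smul, Real.norm_eq_abs]
      refine lt_of_le_of_lt (mul_le_mul_of_nonneg_left ?_ (abs_nonneg _)) hs
      have h1 := (hR z (Or.inr hz)).trans (le_abs_self R)
      have h2 := (hR x (Or.inl hx)).trans (le_abs_self R)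
      linarith [norm_sub_le z x]
    · simp [image_eq_zero_of_notMem_tsupport hz]
  refine (norm_integral_le_of_norm_le (hηi.mul_const ε) (Eventually.of_forall hb)).trans ?_
  rw [integral_mul_const, hη.integral_eq_one, one_mul]

/-- Density argument: approximate `f` in `L²` by a continuous compactly supported `g`, use uniform
convergence for `g` on `S`, and the uniform operator bound for `f - g`. -/
theorem IsMollifier.tendsto_eLpNorm_smoothing_sub (hη : IsMollifier η U) (hf : MemLp f 2)
    (hfm : Measurable f) {S : Set (E d)} (hS : Bornology.IsBounded S) (hSm : MeasurableSet S) :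
    Tendsto (fun s => eLpNorm (fun x => smoothing η s f x - f x) 2 (volume.restrict S))
      (𝓝[<] (1 : ℝ)) (𝓝 0) := by
  have : IsFiniteMeasure (volume.restrict S : Measure (E d)) := ⟨by simpa using hS.measure_lt_top⟩
  rw [ENNReal.tendsto_nhds_zero]
  intro ε hε
  set M : ENNReal := ENNReal.ofReal (2 ^ d) ^ (2 : ℝ)⁻¹ with hM
  have hMtop : M ≠ ⊤ := by simp [hM]
  set V : ENNReal := (volume.restrict S : Measure (E d)) univ ^ (2 : ℝ)⁻¹ with hV
  have hVtop : V ≠ ⊤ := by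
    rw [hV]
    exact ENNReal.rpow_ne_top_of_nonneg (by norm_num) (measure_ne_top _ _)
  obtain ⟨a, ha0, haM⟩ : ∃ a : ENNReal, a ≠ 0 ∧ (M + 1) * a ≤ ε / 2 := by
    refine ⟨ε / 2 / (M + 1), ?_, ENNReal.mul_div_le⟩
    simp [hε.ne', hMtop]
  obtain ⟨b, hb0, hbV⟩ : ∃ b : ℝ, 0 < b ∧ V * ENNReal.ofReal b ≤ ε / 2 := by
    -- The minimum keeps `c` finite when `ε = ⊤`; `V + 1` avoids division by zero.
    set c : ENNReal := min (ε / 2) 1 / (V + 1) with hc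
    have hc0 : c ≠ 0 := by
      simp [hc, hε.ne', hVtop]
    have hct : c ≠ ⊤ := ENNReal.div_ne_top (by simp) (by simp)
    refine ⟨c.toReal, ENNReal.toReal_pos hc0 hct, ?_⟩
    rw [ENNReal.ofReal_toReal hct]
    calc V * c ≤ (V + 1) * c := by gcongr; exact le_self_add
      _ ≤ min (ε / 2) 1 := ENNReal.mul_div_le
      _ ≤ ε / 2 := min_le_left _ _
  obtain ⟨g, hgc, hfg, hg, hgm⟩ := hf.exists_hasCompactSupport_eLpNorm_sub_le (by norm_num) ha0
  filter_upwards [hη.exists_norm_smoothing_sub_le hg hgc hS hb0, self_mem_nhdsWithin,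
    nhdsWithin_le_nhds (Ioi_mem_nhds (by norm_num : (1 / 2 : ℝ) < 1))]
    with s hs hs1 hs2
  have hs1 : s < 1 := hs1
  have c1 := (hη.contDiff_smoothing hs1 hf).continuous
  have c2 := (hη.contDiff_smoothing hs1 hgm).continuous
  have c3 := (hη.contDiff_smoothing hs1 (hf.sub hgm)).continuous
  have e : (fun x => smoothing η s f x - f x) =
      smoothing η s (f - g) + (fun x => smoothing η s g x - g x) - (f - g) := by
    ext x
    simp only [Pi.add_apply, Pi.sub_apply, hη.smoothing_sub hs1 hf hgm]
    ring
  have n1 : eLpNorm (smoothing η s (f - g)) 2 (volume.restrict S) ≤ M * a :=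
    (eLpNorm_mono_measure _ Measure.restrict_le_self).trans
      ((hη.eLpNorm_smoothing_le (le_of_lt hs2) (hfm.sub hg.measurable)).trans (by gcongr))
  have n2 : eLpNorm (fun x => smoothing η s g x - g x) 2 (volume.restrict S) ≤
      V * ENNReal.ofReal b := by
    have := eLpNorm_le_of_ae_bound (p := 2) (μ := volume.restrict S)
      (f := fun x => smoothing η s g x - g x) (C := b)
      ((ae_restrict_mem hSm).mono fun x hx => hs x hx)
    simpa [hV] using this
  have n3 : eLpNorm (f - g) 2 (volume.restrict S) ≤ a :=
    (eLpNorm_mono_measure _ Measure.restrict_le_self).trans hfg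
  rw [e]
  calc _ ≤ eLpNorm (smoothing η s (f - g) + fun x => smoothing η s g x - g x) 2
          (volume.restrict S) + eLpNorm (f - g) 2 (volume.restrict S) :=
        eLpNorm_sub_le (c3.add (c2.sub hg)).aestronglyMeasurable
          (hfm.sub hg.measurable).aestronglyMeasurable (by norm_num)
    _ ≤ (M * a + V * ENNReal.ofReal b) + a := by
        refine add_le_add ((eLpNorm_add_le c3.aestronglyMeasurable
          (c2.sub hg).aestronglyMeasurable (by norm_num)).trans (add_le_add n1 n2)) n3
    _ = (M + 1) * a + V * ENNReal.ofReal b := by ring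
    _ ≤ ε / 2 + ε / 2 := add_le_add haM hbV
    _ = ε := ENNReal.add_halves ε

end Smoothing

end HHO

end

/-! ### Smoothing of functions extended by zero from the cell -/

noncomputable section

namespace HHO

section Smoothing
variable {d : ℕ} {η : E d → ℝ} {U : Set (E d)} {s : ℝ}

theorem memLp_indicator (T : MeshCell d) (w : Lp ℝ 2 T.vol) :
    MemLp (T.carrier.indicator w) 2 (volume : Measure (E d)) :=
  (memLp_indicator_iff_restrict T.isOpen.measurableSet).2 (Lp.memLp w)

theorem measurable_indicator (T : MeshCell d) (w : Lp ℝ 2 T.vol) :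
    Measurable (T.carrier.indicator w) :=
  (Lp.stronglyMeasurable w).measurable.indicator T.isOpen.measurableSet

theorem integral_indicator_mul (T : MeshCell d) (w : Lp ℝ 2 T.vol) (h : E d → ℝ) :
    ∫ x, T.carrier.indicator w x * h x = ∫ x in T.carrier, w x * h x := by
  rw [← integral_indicator T.isOpen.measurableSet]
  congr with x
  by_cases hx : x ∈ T.carrier <;> simp [hx]

/-- On `T`, smoothing with centres in the star ball commutes with weak derivatives, up to the
contraction factor. -/
theorem IsMollifier.partialDeriv_smoothing_of_isWeakDeriv {T : MeshCell d} {x₀ : E d} {r : ℝ}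
    (hB : T.IsStarBall x₀ r) (hη : IsMollifier η (Metric.ball x₀ r)) (hs0 : 0 < s) (hs : s < 1)
    {i : Fin d} {w g : Lp ℝ 2 T.vol} (hg : T.IsWeakDeriv i w g) {x : E d} (hx : x ∈ T.carrier) :
    partialDeriv i (smoothing η s (T.carrier.indicator w)) x =
      s * smoothing η s (T.carrier.indicator g) x := by
  have h1 : (1 - s) ≠ 0 := by linarith
  set ψ : E d → ℝ := fun u => smoothingKernel η s (s • x - u) with hψ
  have hψs : ContDiff ℝ ∞ ψ := hη.contDiff_smoothingKernel.comp (contDiff_const.sub contDiff_id)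
  have hψc : HasCompactSupport ψ :=
    (hη.hasCompactSupport_smoothingKernel hs).comp_homeomorph (Homeomorph.subLeft (s • x))
  -- Points of the support have the form `s x + (1 - s) z` with `z` in the star ball, hence lie in
  -- the cell. So `ψ` is an admissible test function, and the jump of the extension by zero at the
  -- boundary plays no role.
  have hψT : tsupport ψ ⊆ T.carrier := by
    have hpre : tsupport ψ ⊆ (fun u => -((1 - s)⁻¹ • (s • x - u))) ⁻¹' tsupport η :=
      closure_minimal (fun u hu => subset_tsupport η hu)
        ((isClosed_tsupport η).preimage (by fun_prop))
    intro u hu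
    have h2 := hB.mem_of_mem (hη.tsupport_subset (hpre hu)) hx hs0.le hs.le
    convert h2 using 1
    match_scalars <;> field_simp <;> ring
  rw [hη.partialDeriv_smoothing hs (memLp_indicator T w), integral_indicator_mul T w,
    hg ψ hψs hψc hψT, smoothing_eq_integral hs, ← integral_indicator_mul T g]
  simp only [mul_neg, neg_neg]
  congr 3 with v
  rw [mul_comm]

end Smoothing

namespace MeshCell

variable {d : ℕ} (T : MeshCell d)

/-! ### Density of smooth functions and traces -/

/-- The `H¹(T)`-distance of a smooth function to `w`. -/
def h1Dist (w : T.H1) (φ : E d → ℝ) : ENNReal :=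
  eLpNorm (fun x => φ x - w.1 x) 2 T.vol +
    ∑ i, eLpNorm (fun x => partialDeriv i φ x - T.weakDeriv i w x) 2 T.vol

/-- The approximants are the smoothings of the extension by zero with `s n → 1` from below; their
derivatives on the cell are `s n` times smoothings of the weak derivatives. -/
theorem exists_tendsto_h1Dist (w : T.H1) : ∃ φ : ℕ → E d → ℝ, (∀ n, ContDiff ℝ ∞ (φ n)) ∧
    Tendsto (fun n => T.h1Dist w (φ n)) atTop (𝓝 0) := by
  obtain ⟨x₀, r, hB⟩ := T.exists_isStarBall
  obtain ⟨η, hη⟩ := exists_isMollifier x₀ hB.1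
  obtain ⟨s, -, hs, hst⟩ := exists_seq_strictMono_tendsto' (zero_lt_one (α := ℝ))
  have hst' : Tendsto s atTop (𝓝[<] 1) :=
    tendsto_nhdsWithin_iff.2 ⟨hst, Eventually.of_forall fun n => (hs n).2⟩
  have hconv : ∀ u : Lp ℝ 2 T.vol, Tendsto (fun n => eLpNorm (fun x =>
      smoothing η (s n) (T.carrier.indicator u) x - u x) 2 T.vol) atTop (𝓝 0) := by
    intro u
    refine ((hη.tendsto_eLpNorm_smoothing_sub (memLp_indicator T u) (measurable_indicator T u)
      T.isBounded T.isOpen.measurableSet).comp hst').congr fun n => eLpNorm_congr_ae ?_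
    filter_upwards [ae_restrict_mem T.isOpen.measurableSet] with x hx
    simp [hx]
  refine ⟨fun n => smoothing η (s n) (T.carrier.indicator w.1),
    fun n => hη.contDiff_smoothing (hs n).2 (memLp_indicator T w.1), ?_⟩
  have hsum : Tendsto (fun n => ∑ i, eLpNorm (fun x => partialDeriv i
      (smoothing η (s n) (T.carrier.indicator w.1)) x - T.weakDeriv i w x) 2 T.vol)
      atTop (𝓝 (∑ i : Fin d, 0)) := by
    refine tendsto_finsetSum _ fun i _ => ?_
    have hb : Tendsto (fun n => eLpNorm (fun x => smoothing η (s n)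
        (T.carrier.indicator (T.weakDeriv i w)) x - T.weakDeriv i w x) 2 T.vol +
        ‖1 - s n‖ₑ * eLpNorm (T.weakDeriv i w) 2 T.vol) atTop (𝓝 0) := by
      have h1 : Tendsto (fun n => ‖1 - s n‖ₑ) atTop (𝓝 0) := by
        have : Tendsto (fun n => 1 - s n) atTop (𝓝 0) := by simpa using hst.const_sub 1
        simpa using this.enorm
      have h2 := ENNReal.Tendsto.mul_const (b := eLpNorm (T.weakDeriv i w) 2 T.vol) h1
        (Or.inr (Lp.eLpNorm_ne_top _))
      simpa using (hconv (T.weakDeriv i w)).add h2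
    refine tendsto_of_tendsto_of_tendsto_of_le_of_le tendsto_const_nhds hb
      (fun n => zero_le) fun n => ?_
    have hc := (hη.contDiff_smoothing (hs n).2 (memLp_indicator T (T.weakDeriv i w))).continuous
    have hm : AEStronglyMeasurable (fun x => smoothing η (s n)
        (T.carrier.indicator (T.weakDeriv i w)) x - T.weakDeriv i w x) T.vol :=
      hc.aestronglyMeasurable.sub (Lp.aestronglyMeasurable _)
    have e : (fun x => partialDeriv i (smoothing η (s n) (T.carrier.indicator w.1)) x -
        T.weakDeriv i w x) =ᵐ[T.vol]
        s n • (fun x => smoothing η (s n) (T.carrier.indicator (T.weakDeriv i w)) x -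
          T.weakDeriv i w x) - (1 - s n) • (T.weakDeriv i w : E d → ℝ) := by
      filter_upwards [ae_restrict_mem T.isOpen.measurableSet] with x hx
      rw [hη.partialDeriv_smoothing_of_isWeakDeriv hB (hs n).1 (hs n).2
        (T.isWeakDeriv_weakDeriv i w) hx]
      simp only [Pi.sub_apply, Pi.smul_apply, smul_eq_mul]
      ring
    rw [eLpNorm_congr_ae e]
    refine (eLpNorm_sub_le (hm.const_smul _) ((Lp.aestronglyMeasurable _).const_smul _)
      (by norm_num)).trans ?_
    rw [eLpNorm_const_smul, eLpNorm_const_smul]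
    refine add_le_add ?_ le_rfl
    have : ‖s n‖ₑ ≤ 1 := by
      rw [Real.enorm_eq_ofReal (hs n).1.le]
      simpa using (hs n).2.le
    exact mul_le_of_le_one_left' this
  simpa [h1Dist] using (hconv w.1).add hsum

variable {T}

/-- The trace inequality for `φ - ψ`, followed by the triangle inequality through `w`. It yields
both the Cauchy property behind existence of traces and their independence of the approximating
sequence. -/
theorem exists_eLpNorm_sub_surf_le (hd : 1 ≤ d) (F : T.Face) : ∃ C : ℝ, ∀ (w : T.H1)
    (φ ψ : E d → ℝ), ContDiff ℝ ∞ φ → ContDiff ℝ ∞ ψ →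
    eLpNorm (fun x => φ x - ψ x) 2 (T.surf F) ≤
      ENNReal.ofReal C * (T.h1Dist w φ + T.h1Dist w ψ) := by
  obtain ⟨C, hC⟩ := T.exists_eLpNorm_surf_le hd F
  refine ⟨C, fun w φ ψ hφ hψ => ?_⟩
  refine (hC (fun x => φ x - ψ x) ((hφ.sub hψ).of_le (by norm_cast))).trans ?_
  refine mul_le_mul_right ?_ _
  have tri : ∀ (f g : E d → ℝ) (u : Lp ℝ 2 T.vol), Continuous f → Continuous g →
      eLpNorm (fun x => f x - g x) 2 T.vol ≤
        eLpNorm (fun x => f x - u x) 2 T.vol + eLpNorm (fun x => g x - u x) 2 T.vol := by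
    intro f g u hf hg
    have e : (fun x => f x - g x) = (fun x => f x - u x) - fun x => g x - u x := by
      ext x
      simp
    rw [e]
    exact eLpNorm_sub_le (hf.aestronglyMeasurable.sub (Lp.aestronglyMeasurable _))
      (hg.aestronglyMeasurable.sub (Lp.aestronglyMeasurable _)) (by norm_num)
  have hp : ∀ i, partialDeriv i (fun x => φ x - ψ x) =
      fun x => partialDeriv i φ x - partialDeriv i ψ x := by
    intro i
    ext x
    simp only [partialDeriv]
    rw [fderiv_fun_sub (hφ.differentiable (by simp) x) (hψ.differentiable (by simp) x)]
    rfl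
  simp_rw [hp]
  rw [h1Dist, h1Dist, add_add_add_comm, ← Finset.sum_add_distrib]
  exact add_le_add (tri _ _ _ hφ.continuous hψ.continuous) (Finset.sum_le_sum fun i _ =>
    tri _ _ _ (continuous_partialDeriv i hφ) (continuous_partialDeriv i hψ))

theorem tendsto_eLpNorm_sub_surf (hd : 1 ≤ d) (F : T.Face) (w : T.H1) {φ ψ : ℕ → E d → ℝ}
    (hφ : ∀ n, ContDiff ℝ ∞ (φ n)) (hψ : ∀ n, ContDiff ℝ ∞ (ψ n))
    (hφw : Tendsto (fun n => T.h1Dist w (φ n)) atTop (𝓝 0))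
    (hψw : Tendsto (fun n => T.h1Dist w (ψ n)) atTop (𝓝 0)) :
    Tendsto (fun n => eLpNorm (fun x => φ n x - ψ n x) 2 (T.surf F)) atTop (𝓝 0) := by
  obtain ⟨C, hC⟩ := exists_eLpNorm_sub_surf_le hd F
  have h := ENNReal.Tendsto.const_mul (a := ENNReal.ofReal C) (hφw.add hψw) (Or.inr (by simp))
  rw [add_zero, mul_zero] at h
  exact tendsto_of_tendsto_of_tendsto_of_le_of_le tendsto_const_nhds h (fun n => zero_le)
    fun n => hC w _ _ (hφ n) (hψ n)

theorem exists_isTrace (hd : 1 ≤ d) (F : T.Face) (w : T.H1) : ∃ g, T.IsTrace F w g := by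
  obtain ⟨φ, hφ, hφw⟩ := T.exists_tendsto_h1Dist w
  obtain ⟨C, hC⟩ := exists_eLpNorm_sub_surf_le hd F
  have hm : ∀ n, MemLp (φ n) 2 (T.surf F) := fun n => T.memLp_surf F (hφ n).continuous
  have hcau : CauchySeq fun n => (hm n).toLp := by
    rw [EMetric.cauchySeq_iff]
    intro ε hε
    have h := ENNReal.Tendsto.const_mul (a := ENNReal.ofReal C) hφw (Or.inr (by simp))
    rw [mul_zero] at h
    obtain ⟨N, hN⟩ := eventually_atTop.1 (h.eventually_lt_const (ENNReal.half_pos hε.ne'))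
    refine ⟨N, fun m hmN n hnN => ?_⟩
    rw [Lp.edist_toLp_toLp]
    refine lt_of_le_of_lt (hC w _ _ (hφ m) (hφ n)) ?_
    rw [mul_add, ← ENNReal.add_halves ε]
    exact ENNReal.add_lt_add (hN m hmN) (hN n hnN)
  obtain ⟨g, hg⟩ := cauchySeq_tendsto_of_complete hcau
  refine ⟨g, φ, hφ, ?_, fun i => ?_, ?_⟩
  · exact tendsto_of_tendsto_of_tendsto_of_le_of_le tendsto_const_nhds hφw (fun n => zero_le)
      fun n => le_self_add
  · exact tendsto_of_tendsto_of_tendsto_of_le_of_le tendsto_const_nhds hφw (fun n => zero_le)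
      fun n => (Finset.single_le_sum (f := fun i => eLpNorm (fun x => partialDeriv i (φ n) x -
        T.weakDeriv i w x) 2 T.vol) (fun _ _ => zero_le) (Finset.mem_univ i)).trans
        le_add_self
  · rw [Lp.tendsto_Lp_iff_tendsto_eLpNorm'] at hg
    refine hg.congr fun n => eLpNorm_congr_ae ?_
    filter_upwards [(hm n).coeFn_toLp] with x hx
    simp [hx]

theorem isTrace_trace (hd : 1 ≤ d) (F : T.Face) (w : T.H1) : T.IsTrace F w (T.trace F w) := by
  rw [trace, dif_pos (exists_isTrace hd F w)]
  exact Classical.choose_spec (exists_isTrace hd F w)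

/-- `IsTrace` provides some sequence for each face separately; this lets a single approximating
sequence serve all faces at once. -/
theorem tendsto_eLpNorm_sub_trace (hd : 1 ≤ d) (F : T.Face) (w : T.H1) {φ : ℕ → E d → ℝ}
    (hφ : ∀ n, ContDiff ℝ ∞ (φ n)) (hφw : Tendsto (fun n => T.h1Dist w (φ n)) atTop (𝓝 0)) :
    Tendsto (fun n => eLpNorm (fun x => φ n x - T.trace F w x) 2 (T.surf F)) atTop (𝓝 0) := by
  obtain ⟨ψ, hψ, h0, h1, h2⟩ := isTrace_trace hd F w
  have hψw : Tendsto (fun n => T.h1Dist w (ψ n)) atTop (𝓝 0) := by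
    simpa [h1Dist] using h0.add (tendsto_finsetSum Finset.univ fun i _ => h1 i)
  have h := (tendsto_eLpNorm_sub_surf hd F w hφ hψ hφw hψw).add h2
  rw [add_zero] at h
  refine tendsto_of_tendsto_of_tendsto_of_le_of_le tendsto_const_nhds h (fun n => zero_le)
    fun n => ?_
  have e : (fun x => φ n x - T.trace F w x) =
      (fun x => φ n x - ψ n x) + fun x => ψ n x - T.trace F w x := by
    ext x
    simp
  rw [e]
  exact eLpNorm_add_le ((hφ n).continuous.sub (hψ n).continuous).aestronglyMeasurable
    ((hψ n).continuous.aestronglyMeasurable.sub (Lp.aestronglyMeasurable _)) (by norm_num)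

end MeshCell

end HHO

end

noncomputable section

namespace HHO

variable {d : ℕ}

/-! ### Polynomials -/

theorem contDiff_eval (q : MvPolynomial (Fin d) ℝ) :
    ContDiff ℝ ∞ fun x : E d => MvPolynomial.eval x.ofLp q := by
  induction q using MvPolynomial.induction_on with
  | C a => simpa using contDiff_const
  | add p q hp hq => simpa using hp.add hq
  | mul_X p i hp => simpa using hp.mul (by fun_prop : ContDiff ℝ ∞ fun x : E d => x i)

theorem partialDeriv_mul {φ ψ : E d → ℝ} (hφ : Differentiable ℝ φ) (hψ : Differentiable ℝ ψ)
    (i : Fin d) (x : E d) : partialDeriv i (fun x => φ x * ψ x) x =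
      partialDeriv i φ x * ψ x + φ x * partialDeriv i ψ x := by
  rw [partialDeriv, fderiv_fun_mul (hφ x) (hψ x)]
  simp [partialDeriv]
  ring

theorem partialDeriv_eval (q : MvPolynomial (Fin d) ℝ) (i : Fin d) (x : E d) :
    partialDeriv i (fun x : E d => MvPolynomial.eval x.ofLp q) x =
      MvPolynomial.eval x.ofLp (MvPolynomial.pderiv i q) := by
  have hdiff := fun q : MvPolynomial (Fin d) ℝ => (contDiff_eval q).differentiable (by simp)
  induction q using MvPolynomial.induction_on with
  | C a => simp [partialDeriv]
  | add p q hp hq =>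
    simp only [map_add, ← hp, ← hq, partialDeriv]
    rw [fderiv_fun_add (hdiff p x) (hdiff q x)]
    rfl
  | mul_X p j hp =>
    have hX : partialDeriv i (fun x : E d => x.ofLp j) x = if i = j then 1 else 0 := by
      have h : HasFDerivAt (fun x : E d => x.ofLp j)
        (EuclideanSpace.proj j : E d →L[ℝ] ℝ) x :=
        ContinuousLinearMap.hasFDerivAt (EuclideanSpace.proj j : E d →L[ℝ] ℝ)
      rw [partialDeriv, h.fderiv]
      simp [eq_comm]
    simp only [map_mul, MvPolynomial.eval_X]
    rw [partialDeriv_mul (hdiff p) (by fun_prop), hp, hX, MvPolynomial.pderiv_mul,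
      MvPolynomial.pderiv_X]
    by_cases hij : i = j
    · subst hij
      simp
    · simp [hij, eq_comm]

/-- Differentiation never raises an exponent; the drop in degree is not needed. -/
theorem pderiv_mem_restrictTotalDegree {k : ℕ} {q : MvPolynomial (Fin d) ℝ}
    (hq : q ∈ MvPolynomial.restrictTotalDegree (Fin d) ℝ k) (i : Fin d) :
    MvPolynomial.pderiv i q ∈ MvPolynomial.restrictTotalDegree (Fin d) ℝ k := by
  rw [← MvPolynomial.support_sum_monomial_coeff q, map_sum]
  refine Submodule.sum_mem _ fun s hs => ?_
  rw [MvPolynomial.pderiv_monomial, MvPolynomial.mem_restrictTotalDegree]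
  refine (MvPolynomial.totalDegree_monomial_le _ _).trans ?_
  rw [MvPolynomial.mem_restrictTotalDegree] at hq
  refine le_trans ?_ ((MvPolynomial.le_totalDegree hs).trans hq)
  rw [Finsupp.sum_fintype _ _ (by simp), Finsupp.sum_fintype _ _ (by simp)]
  exact Finset.sum_le_sum fun j _ => by simp

/-- The projection error is orthogonal to `q`. A general `μ` covers the cell and its faces together.
-/
theorem integral_polyProj_mul {k : ℕ} {μ : Measure (E d)} (f : Lp ℝ 2 μ)
    {q : MvPolynomial (Fin d) ℝ} (hq : q ∈ MvPolynomial.restrictTotalDegree (Fin d) ℝ k)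
    (hm : MemLp (fun x : E d => MvPolynomial.eval x.ofLp q) 2 μ) :
    ∫ x, (polyProj k μ f : Lp ℝ 2 μ) x * MvPolynomial.eval x.ofLp q ∂μ =
      ∫ x, f x * MvPolynomial.eval x.ofLp q ∂μ := by
  have hin : ∀ g : Lp ℝ 2 μ, inner ℝ g hm.toLp = ∫ x, g x * MvPolynomial.eval x.ofLp q ∂μ := by
    intro g
    rw [L2.inner_def]
    apply integral_congr_ae
    filter_upwards [hm.coeFn_toLp] with x hx
    simp [hx, mul_comm]
  rw [← hin, ← hin]
  exact Submodule.inner_orthogonalProjectionOnto_eq_of_mem_right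
    (⟨hm.toLp, q, hq, hm.coeFn_toLp⟩ : polySpace k μ) f

theorem integral_sum_mul {μ : Measure (E d)} (f : Fin d → Lp ℝ 2 μ) {h : Fin d → E d → ℝ}
    (hh : ∀ i, MemLp (h i) 2 μ) :
    ∫ x, ∑ i, f i x * h i x ∂μ = ∑ i, ∫ x, f i x * h i x ∂μ :=
  integral_finsetSum (f := fun i x => f i x * h i x) _
    fun i _ => (Lp.memLp (f i)).integrable_mul (hh i)

/-- By Hölder, multiplication by a fixed `L²` function is continuous from `L²` to `L¹`. -/
theorem tendsto_integral_mul {μ : Measure (E d)} {f : ℕ → E d → ℝ} {g h : E d → ℝ}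
    (hf : ∀ n, MemLp (f n) 2 μ) (hg : MemLp g 2 μ) (hh : MemLp h 2 μ)
    (hfg : Tendsto (fun n => eLpNorm (fun x => f n x - g x) 2 μ) atTop (𝓝 0)) :
    Tendsto (fun n => ∫ x, f n x * h x ∂μ) atTop (𝓝 (∫ x, g x * h x ∂μ)) := by
  refine tendsto_integral_of_L1' (fun x => g x * h x) (hg.integrable_mul hh).aestronglyMeasurable
    (Eventually.of_forall fun n => (hf n).integrable_mul hh) ?_
  have hlim := ENNReal.Tendsto.mul_const (b := eLpNorm h 2 μ) hfg (Or.inr hh.eLpNorm_ne_top)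
  rw [zero_mul] at hlim
  refine tendsto_of_tendsto_of_tendsto_of_le_of_le tendsto_const_nhds hlim (fun n => zero_le)
    fun n => ?_
  have e : ((fun x => f n x * h x) - fun x => g x * h x) = (fun x => f n x - g x) • h := by
    ext x
    simp [sub_mul]
  rw [e]
  exact eLpNorm_smul_le_mul_eLpNorm hh.aestronglyMeasurable
    ((hf n).sub hg).aestronglyMeasurable

namespace MeshCell

variable (T : MeshCell d)

/-! ### Integration by parts and the commuting property -/

/-- The divergence theorem for the products `φ n * q`, with `φ n` smooth and tending to `w` in
`H¹(T)`; each of the three kinds of integral converges. -/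
theorem integral_weakDeriv_mul (hd : 1 ≤ d) (w : T.H1) (i : Fin d) {q : E d → ℝ}
    (hq : ContDiff ℝ ∞ q) :
    ∫ x in T.carrier, T.weakDeriv i w x * q x =
      -(∫ x in T.carrier, w.1 x * partialDeriv i q x) +
        ∑ F : T.Face, ∫ x, T.trace F w x * (q x * T.normal F i) ∂(T.surf F) := by
  obtain ⟨φ, hφ, hφw⟩ := T.exists_tendsto_h1Dist w
  have hqc := hq.continuous
  have hqd := continuous_partialDeriv i hq
  have hφd := fun n => continuous_partialDeriv i (hφ n)
  have hparts : ∀ n, ∫ x in T.carrier, partialDeriv i (φ n) x * q x =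
      -(∫ x in T.carrier, φ n x * partialDeriv i q x) +
        ∑ F : T.Face, ∫ x, φ n x * (q x * T.normal F i) ∂(T.surf F) := by
    intro n
    have h := T.integral_partialDeriv hd (((hφ n).mul hq).of_le (by norm_cast)) i
    simp only [partialDeriv_mul ((hφ n).differentiable (by simp)) (hq.differentiable (by simp)),
      mul_assoc] at h
    rw [integral_add (f := fun x => partialDeriv i (φ n) x * q x)
      (g := fun x => φ n x * partialDeriv i q x) (T.integrable_vol ((hφd n).mul hqc))
      (T.integrable_vol ((hφ n).continuous.mul hqd))] at h
    rw [← h]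
    ring
  have h0 : Tendsto (fun n => eLpNorm (fun x => φ n x - w.1 x) 2 T.vol) atTop (𝓝 0) :=
    tendsto_of_tendsto_of_tendsto_of_le_of_le tendsto_const_nhds hφw (fun n => zero_le)
      fun n => le_self_add
  have h1 : Tendsto (fun n => eLpNorm (fun x => partialDeriv i (φ n) x - T.weakDeriv i w x) 2
      T.vol) atTop (𝓝 0) :=
    tendsto_of_tendsto_of_tendsto_of_le_of_le tendsto_const_nhds hφw (fun n => zero_le)
      fun n => (Finset.single_le_sum (f := fun i => eLpNorm (fun x => partialDeriv i (φ n) x -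
        T.weakDeriv i w x) 2 T.vol) (fun _ _ => zero_le) (Finset.mem_univ i)).trans le_add_self
  have l1 := tendsto_integral_mul (fun n => T.memLp_vol (hφd n)) (Lp.memLp _)
    (T.memLp_vol hqc) h1
  have l2 := tendsto_integral_mul (fun n => T.memLp_vol (hφ n).continuous) (Lp.memLp _)
    (T.memLp_vol hqd) h0
  have l3 := fun F : T.Face => tendsto_integral_mul
    (fun n => T.memLp_surf F (hφ n).continuous) (Lp.memLp (T.trace F w))
    (T.memLp_surf F (hqc.mul_const (T.normal F i))) (tendsto_eLpNorm_sub_trace hd F w hφ hφw)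
  refine tendsto_nhds_unique l1 ?_
  simp_rw [hparts]
  exact l2.neg.add (tendsto_finsetSum _ fun F _ => l3 F)

theorem divRhs_reduction (hd : 1 ≤ d) {k : ℕ} (v : Fin d → T.H1) {q : MvPolynomial (Fin d) ℝ}
    (hq : q ∈ MvPolynomial.restrictTotalDegree (Fin d) ℝ k) :
    T.divRhs (T.reduction k v) q =
      ∫ x in T.carrier, T.div v x * MvPolynomial.eval x.ofLp q := by
  have hdiv : ∫ x in T.carrier, T.div v x * MvPolynomial.eval x.ofLp q =
      ∑ i, ∫ x in T.carrier, T.weakDeriv i (v i) x * MvPolynomial.eval x.ofLp q := by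
    rw [← integral_sum_mul (fun i => T.weakDeriv i (v i)) fun _ => T.memLp_cell q]
    apply integral_congr_ae
    filter_upwards [Lp.coeFn_finsetSum Finset.univ fun i => T.weakDeriv i (v i)] with x hx
    rw [div, hx, Finset.sum_apply, Finset.sum_mul]
  have hcell : ∫ x in T.carrier, ∑ i, ((T.reduction k v).1 i : Lp ℝ 2 T.vol) x *
      MvPolynomial.eval x.ofLp (MvPolynomial.pderiv i q) =
      ∑ i, ∫ x in T.carrier, (v i).1 x * MvPolynomial.eval x.ofLp (MvPolynomial.pderiv i q) := by
    rw [integral_sum_mul (fun i => ((T.reduction k v).1 i : Lp ℝ 2 T.vol))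
      fun i => T.memLp_cell (MvPolynomial.pderiv i q)]
    exact Finset.sum_congr rfl fun i _ =>
      integral_polyProj_mul _ (pderiv_mem_restrictTotalDegree hq i) (T.memLp_cell _)
  have hface : ∀ F : T.Face, ∫ x, ∑ i, ((T.reduction k v).2 F i : Lp ℝ 2 (T.surf F)) x *
      (MvPolynomial.eval x.ofLp q * T.normal F i) ∂(T.surf F) =
      ∑ i, ∫ x, T.trace F (v i) x * (MvPolynomial.eval x.ofLp q * T.normal F i) ∂(T.surf F) := by
    intro F
    rw [integral_sum_mul (fun i => ((T.reduction k v).2 F i : Lp ℝ 2 (T.surf F)))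
      fun i => (T.memLp_face F q).mul_const (T.normal F i)]
    refine Finset.sum_congr rfl fun i _ => ?_
    -- The normal is constant on the face, so it leaves the integral and the test function is `q`
    -- itself, of degree at most `k`.
    simp only [← mul_assoc, integral_mul_const]
    congr 1
    exact integral_polyProj_mul _ hq (T.memLp_face F q)
  rw [divRhs, hcell, hdiv]
  simp_rw [hface, fun i => T.integral_weakDeriv_mul hd (v i) i (contDiff_eval q),
    partialDeriv_eval]
  rw [Finset.sum_add_distrib, Finset.sum_neg_distrib, Finset.sum_comm]

end MeshCell

end HHO

end

theorem mainTheorem11 (d : ℕ) (hd : d = 2 ∨ d = 3) (k : ℕ) (hk : 1 ≤ k)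
    (T : HHO.MeshCell d) (v : Fin d → T.H1) :
    T.divRec (T.reduction k v) = HHO.polyProj k T.vol (T.div v) := by
  have hd1 : 1 ≤ d := by omega
  -- Both sides solve the same well-posed problem.
  refine (T.existsUnique_divRec (T.reduction k v)).unique
    (fun q hq => T.divRec_spec _ q hq) fun q hq => ?_
  rw [T.divRhs_reduction hd1 v hq]
  exact HHO.integral_polyProj_mul _ hq (T.memLp_cell q)
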